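/- Consider $n$ rigid jobs to be scheduled on $m$ identical speed-scalable processors. Job $j$ has a release time $r_j$, a deadline $d_j>r_j$, a processing volume $W_j>0$, and must be executed by exactly $size_j\ge 1$ processors simultaneously. In a feasible (non-preemptive, non-migratory) schedule each job $j$ occupies a fixed set of $size_j$ processors throughout one time interval contained in $[r_j,d_j)$; at each time all these processors run at a common speed, which may vary over time and whose integral over the interval equals $W_j$; and no processor executes two jobs at the same time. A processor running at speed $s$ consumes power $s^\alpha$, where $\alpha>1$; the energy of a schedule is the power integrated over time and summed over all processors. A feasible schedule is called $\rho$-approximate if its energy is at most $\rho$ times the energy of every feasible schedule. Suppose that $size_j\le m/2$ for all jobs $j$. Then a $\left(3-\frac{4}{m+1}\right)^{\alpha-1}$-approximate schedule (start times, job speeds, and sets of processors, each set given as a union of ranges of consecutively numbered processors) can be found in $O(n^2)$ time in each of the following two cases: (a) all jobs have a common release time and individual deadlines; (b) all jobs have a common deadline and individual release times. Time is the number of steps on a real random access machine with unit-cost memory accesses, arithmetic operations $+,-,\times,/$ on reals, $+,-$ on natural numbers, conversion of naturals to reals, and comparisons. In each case a single program works for all instances and all $\alpha>1$, and the constant hidden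 in $O(n^2)$ is absolute. -/

import Mathlib

open scoped NNReal ENNReal

namespace SpeedScaling

/-! ## Speed scaling of rigid parallel jobs -/

/-- An instance: `n` rigid jobs on `m` identical processors. Job `j` needs `size j` processors
simultaneously, has the processing volume `work j`, and has to be processed within
`[release j, deadline j)`. -/
structure RigidInstance where
  n : ℕ
  m : ℕ
  size : Fin n → ℕ
  work : Fin n → ℝ
  release : Fin n → ℝ
  deadline : Fin n → ℝ
  size_pos : ∀ j, 0 < size j
  size_le : ∀ j, size j ≤ m
  work_pos : ∀ j, 0 < work j
  release_lt_deadline : ∀ j, release j < deadline j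

/-- A schedule without preemption and without migration: job `j` occupies the fixed processors
`procs j` throughout one time interval `[start j, finish j)`, and at time `t` of this interval
all these processors run at the (possibly varying) speed `speed j t`. -/
structure Schedule (I : RigidInstance) where
  procs : Fin I.n → Finset (Fin I.m)
  start : Fin I.n → ℝ
  finish : Fin I.n → ℝ
  speed : Fin I.n → ℝ → ℝ≥0

namespace Schedule

variable {I : RigidInstance}

/-- Feasibility: every job gets the required number of processors, is processed completely
between its release time and its deadline, and no processor executes two jobs at a time. -/
structure Feasible (S : Schedule I) : Prop where
  card_procs : ∀ j, (S.procs j).card = I.size j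
  release_le_start : ∀ j, I.release j ≤ S.start j
  start_le_finish : ∀ j, S.start j ≤ S.finish j
  finish_le_deadline : ∀ j, S.finish j ≤ I.deadline j
  measurable_speed : ∀ j, Measurable (S.speed j)
  work_done : ∀ j, ∫⁻ t in Set.Ico (S.start j) (S.finish j), (S.speed j t : ℝ≥0∞)
    = ENNReal.ofReal (I.work j)
  no_overlap : ∀ i j, i ≠ j → ∀ p, p ∈ S.procs i → p ∈ S.procs j →
    Disjoint (Set.Ico (S.start i) (S.finish i)) (Set.Ico (S.start j) (S.finish j))

/-- Total energy on all processors: a processor running at speed `s` has power `s ^ α`, and each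
of the `size j` processors of job `j` runs at the speed of the job. -/
noncomputable def energy (S : Schedule I) (α : ℝ) : ℝ≥0∞ :=
  ∑ j, (I.size j : ℝ≥0∞) *
    ∫⁻ t in Set.Ico (S.start j) (S.finish j), ((S.speed j t ^ α : ℝ≥0) : ℝ≥0∞)

/-- `S` is a `ρ`-approximate schedule: it is feasible and its energy is at most `ρ` times the
energy of any feasible schedule. -/
def IsApproximate (S : Schedule I) (α ρ : ℝ) : Prop :=
  S.Feasible ∧
    ∀ S' : Schedule I, S'.Feasible → S.energy α ≤ ENNReal.ofReal ρ * S'.energy α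

end Schedule

/-! ## A real random access machine with step count

The memory consists of arrays of natural numbers and arrays of real numbers; a program names its
finitely many arrays by constants, the position inside an array is computed (indirect
addressing). Natural numbers can be added, subtracted and compared; real numbers can be added,
subtracted, multiplied, divided and compared; a natural number can be converted to a real number.
Every memory access, operation, comparison and assignment costs one step. -/

/-- Memory contents: entry `i` of the array `a` of naturals is `nat a i`, that of the array `a` of
reals is `real a i`. -/
structure State where
  nat : ℕ → ℕ → ℕ
  real : ℕ → ℕ → ℝ

/-- Write a natural number into the memory. -/
def State.writeNat (s : State) (a i v : ℕ) : State :=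
  { s with nat := Function.update s.nat a (Function.update (s.nat a) i v) }

/-- Write a real number into the memory. -/
def State.writeReal (s : State) (a i : ℕ) (v : ℝ) : State :=
  { s with real := Function.update s.real a (Function.update (s.real a) i v) }

/-- Expressions with natural values; `read a i` is entry `i` of array `a`. -/
inductive NatExpr where
  | const (c : ℕ)
  | read (a : ℕ) (i : NatExpr)
  | add (x y : NatExpr)
  | sub (x y : NatExpr)

/-- The value of an expression; subtraction is truncated at zero. -/
def NatExpr.eval (s : State) : NatExpr → ℕ
  | .const c => c
  | .read a i => s.nat a (i.eval s)
  | .add x y => x.eval s + y.eval s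
  | .sub x y => x.eval s - y.eval s

/-- The number of steps of an evaluation. -/
def NatExpr.cost : NatExpr → ℕ
  | .const _ => 1
  | .read _ i => i.cost + 1
  | .add x y => x.cost + y.cost + 1
  | .sub x y => x.cost + y.cost + 1

/-- Expressions with real values. -/
inductive RealExpr where
  | ofNat (e : NatExpr)
  | read (a : ℕ) (i : NatExpr)
  | add (x y : RealExpr)
  | sub (x y : RealExpr)
  | mul (x y : RealExpr)
  | div (x y : RealExpr)

/-- The value of an expression. -/
noncomputable def RealExpr.eval (s : State) : RealExpr → ℝ
  | .ofNat e => (e.eval s : ℝ)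
  | .read a i => s.real a (i.eval s)
  | .add x y => x.eval s + y.eval s
  | .sub x y => x.eval s - y.eval s
  | .mul x y => x.eval s * y.eval s
  | .div x y => x.eval s / y.eval s

/-- The number of steps of an evaluation. -/
def RealExpr.cost : RealExpr → ℕ
  | .ofNat e => e.cost + 1
  | .read _ i => i.cost + 1
  | .add x y => x.cost + y.cost + 1
  | .sub x y => x.cost + y.cost + 1
  | .mul x y => x.cost + y.cost + 1
  | .div x y => x.cost + y.cost + 1

/-- Comparisons. -/
inductive Cond where
  | natEq (x y : NatExpr)
  | natLt (x y : NatExpr)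
  | realEq (x y : RealExpr)
  | realLt (x y : RealExpr)
  | realLe (x y : RealExpr)

/-- The truth value of a comparison. -/
def Cond.Holds (s : State) : Cond → Prop
  | .natEq x y => x.eval s = y.eval s
  | .natLt x y => x.eval s < y.eval s
  | .realEq x y => x.eval s = y.eval s
  | .realLt x y => x.eval s < y.eval s
  | .realLe x y => x.eval s ≤ y.eval s

/-- The number of steps of a comparison. -/
def Cond.cost : Cond → ℕ
  | .natEq x y => x.cost + y.cost + 1
  | .natLt x y => x.cost + y.cost + 1
  | .realEq x y => x.cost + y.cost + 1
  | .realLt x y => x.cost + y.cost + 1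
  | .realLe x y => x.cost + y.cost + 1

/-- Programs. -/
inductive Program where
  | skip
  | assignNat (a : ℕ) (i e : NatExpr)
  | assignReal (a : ℕ) (i : NatExpr) (e : RealExpr)
  | seq (P Q : Program)
  | cond (b : Cond) (P Q : Program)
  | loop (b : Cond) (P : Program)

/-- `Exec P s s' t`: started in the state `s`, the program `P` halts in the state `s'` after
exactly `t` steps. `loop b P` repeats `P` as long as `b` holds. -/
inductive Exec : Program → State → State → ℕ → Prop where
  | skip (s : State) : Exec .skip s s 1
  | assignNat (a : ℕ) (i e : NatExpr) (s : State) :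
      Exec (.assignNat a i e) s (s.writeNat a (i.eval s) (e.eval s)) (i.cost + e.cost + 1)
  | assignReal (a : ℕ) (i : NatExpr) (e : RealExpr) (s : State) :
      Exec (.assignReal a i e) s (s.writeReal a (i.eval s) (e.eval s)) (i.cost + e.cost + 1)
  | seq {P Q : Program} {s s' s'' : State} {t t' : ℕ} :
      Exec P s s' t → Exec Q s' s'' t' → Exec (.seq P Q) s s'' (t + t')
  | condTrue {b : Cond} {P Q : Program} {s s' : State} {t : ℕ} :
      b.Holds s → Exec P s s' t → Exec (.cond b P Q) s s' (b.cost + t)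
  | condFalse {b : Cond} {P Q : Program} {s s' : State} {t : ℕ} :
      ¬ b.Holds s → Exec Q s s' t → Exec (.cond b P Q) s s' (b.cost + t)
  | loopDone {b : Cond} {P : Program} {s : State} :
      ¬ b.Holds s → Exec (.loop b P) s s b.cost
  | loopStep {b : Cond} {P : Program} {s s' s'' : State} {t t' : ℕ} :
      b.Holds s → Exec P s s' t → Exec (.loop b P) s' s'' t' →
        Exec (.loop b P) s s'' (b.cost + t + t')

/-! ## Input and output of scheduling programs -/

/-- The initial memory. Naturals: array `0` holds `n, m`, array `1` the sizes. Reals: arrays `0`,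
`1`, `2` hold the works, release times and deadlines. All other entries are zero. -/
def RigidInstance.input (I : RigidInstance) : State where
  nat a i :=
    if a = 0 then (if i = 0 then I.n else if i = 1 then I.m else 0)
    else if a = 1 then (if h : i < I.n then I.size ⟨i, h⟩ else 0)
    else 0
  real a i :=
    if h : i < I.n then
      if a = 0 then I.work ⟨i, h⟩
      else if a = 1 then I.release ⟨i, h⟩
      else if a = 2 then I.deadline ⟨i, h⟩
      else 0
    else 0

/-- The schedule written in the memory. The arrays `3` and `4` of reals hold the start times and
the constant speeds of the jobs, so that job `j` runs for `work j / speed j` time units. The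
processor assignment is a list of `B` records in the arrays `3`, `4`, `5` of naturals, with `B`
in entry `0` of array `2`: the record `(j, f, l)` assigns the processors `f, …, l - 1` to
job `j`. -/
noncomputable def RigidInstance.output (I : RigidInstance) (s : State) : Schedule I where
  procs j := Finset.univ.filter fun p : Fin I.m =>
    ∃ b < s.nat 2 0, s.nat 3 b = (j : ℕ) ∧ s.nat 4 b ≤ (p : ℕ) ∧ (p : ℕ) < s.nat 5 b
  start j := s.real 3 j
  finish j := s.real 3 j + I.work j / s.real 4 j
  speed j _ := (s.real 4 j).toNNReal

end SpeedScaling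

/-! The energy is bounded from below through a relaxation that keeps only the durations q_j of the
jobs. With a common release time or a common deadline the time windows are nested, so the jobs up to
position k in the order of the window lengths d all run inside the window of the k-th one. Hence q_j
≤ d_j and Σ_{j ≤ k} size_j q_j ≤ m d_k (`Schedule.Feasible.durations`).

The relaxation is solved exactly by lowering one common speed from a large value until a constraint
becomes tight. A tight window freezes that job at the current speed, a tight load constraint at k
freezes all unfrozen jobs up to k; then the speed of the other jobs is lowered further. The final
speeds v satisfy Σ size_j v_j^a (q_j - w_j / v_j) ≤ 0 for all admissible q and all a > 0: after each
round the sum over the frozen jobs with weights 1 is nonpositive, and the weights v^a do not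
increase from round to round, so Abel summation applies (`FreezeInv.freeze`). With a = α and the
tangent inequality y^α ≥ α v^(α-1) y - (α-1) v^α, every feasible schedule has energy at least Σ
size_j v_j^(α-1) w_j (`JobData.Optimal.energy_le`). The speeds do not depend on α, so one program
serves all α.

List scheduling with the durations p_j = w_j / v_j starts the jobs strictly in the order of the
window lengths. While job k waits, fewer than size_k ≤ m/2 processors are free, so at least (m+1)/2
are busy. If job k starts at t, then (m+1)/2 · t + size_k p_k ≤ Σ_{j ≤ k} size_j p_j ≤ m d_k, and
with p_k ≤ d_k and size_k ≥ 1 this gives (m+1)(t + p_k) ≤ (3m-1) d_k (`AssignInv.finish`).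
Multiplying all speeds by ρ = (3m-1)/(m+1) = 3 - 4/(m+1) makes every job fit into its window and
multiplies the energy by ρ^(α-1). For a common deadline the schedule is run backwards.

For the running time, the processors are kept as segments with a common time of becoming free. Each
job splits at most one segment, so there are O(n) of them. There are n rounds of sorting, at most n
+ 1 rounds of freezing and at most 2n rounds of list scheduling, each of linear cost. Partial
results are composed by the rules for `Runs`, which carry a step bound along with a postcondition.
-/

namespace SpeedScaling

/-! ## Weakest preconditions and step bounds -/

/-- The weakest precondition of a loop-free program. -/
def Program.wp : Program → (State → Prop) → State → Prop
  | .skip, Q, s => Q s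
  | .assignNat a i e, Q, s => Q (s.writeNat a (i.eval s) (e.eval s))
  | .assignReal a i e, Q, s => Q (s.writeReal a (i.eval s) (e.eval s))
  | .seq P R, Q, s => P.wp (R.wp Q) s
  | .cond b P R, Q, s => (b.Holds s → P.wp Q s) ∧ (¬ b.Holds s → R.wp Q s)
  | .loop _ _, _, _ => False

/-- An upper bound for the number of steps of a loop-free program. -/
def Program.bound : Program → ℕ
  | .skip => 1
  | .assignNat _ i e => i.cost + e.cost + 1
  | .assignReal _ i e => i.cost + e.cost + 1
  | .seq P R => P.bound + R.bound
  | .cond b P R => b.cost + (P.bound + R.bound)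
  | .loop _ _ => 0

/-- Symbolic execution with a static step bound, so that loop-free code needs no reasoning about
`Exec`. The value 0 of `Program.bound` at loops is harmless because their precondition is `False`.
-/
theorem Program.exec_of_wp (P : Program) : ∀ (Q : State → Prop) (s : State), P.wp Q s →
    ∃ s' t, Exec P s s' t ∧ t ≤ P.bound ∧ Q s' := by
  induction P with
  | skip => exact fun Q s h => ⟨s, 1, .skip s, le_rfl, h⟩
  | assignNat a i e => exact fun Q s h => ⟨_, _, .assignNat a i e s, le_rfl, h⟩
  | assignReal a i e => exact fun Q s h => ⟨_, _, .assignReal a i e s, le_rfl, h⟩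
  | seq P R hP hR =>
    intro Q s h
    obtain ⟨s', t, h1, h2, h3⟩ := hP _ s h
    obtain ⟨s'', t', h4, h5, h6⟩ := hR _ s' h3
    exact ⟨s'', t + t', .seq h1 h4, Nat.add_le_add h2 h5, h6⟩
  | cond b P R hP hR =>
    intro Q s h
    by_cases hb : b.Holds s
    · obtain ⟨s', t, h1, h2, h3⟩ := hP _ s (h.1 hb)
      exact ⟨s', _, .condTrue hb h1, by simp only [Program.bound]; omega, h3⟩
    · obtain ⟨s', t, h1, h2, h3⟩ := hR _ s (h.2 hb)
      exact ⟨s', _, .condFalse hb h1, by simp only [Program.bound]; omega, h3⟩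
  | loop b P _ => exact fun Q s h => h.elim

/-! ## The memory layout -/

/-- The contents of the working memory. -/
structure Mem where
  B : ℕ
  rj : ℕ → ℕ
  rlo : ℕ → ℕ
  rhi : ℕ → ℕ
  fr : ℕ → ℕ
  ord : ℕ → ℕ
  slo : ℕ → ℕ
  shi : ℕ → ℕ
  k : ℕ
  i : ℕ
  r : ℕ
  lo : ℕ
  hi : ℕ
  c : ℕ
  rem : ℕ
  start : ℕ → ℝ
  speed : ℕ → ℝ
  off : ℕ → ℝ
  v : ℕ → ℝ
  f : ℕ → ℝ
  u : ℝ
  A : ℝ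
  V : ℝ
  t : ℝ

/-- The array holding `x` at position `0`. -/
def single {α : Type} [Zero α] (x : α) (i : ℕ) : α := if i = 0 then x else 0

/-- The arrays of naturals. -/
def natArrays (I : RigidInstance) (M : Mem) : List (ℕ → ℕ) :=
  [I.input.nat 0, I.input.nat 1, single M.B, M.rj, M.rlo, M.rhi, M.fr, M.ord, M.slo, M.shi,
    single M.k, single M.i, single M.r, single M.lo, single M.hi, single M.c, single M.rem]

/-- The arrays of reals. -/
noncomputable def realArrays (I : RigidInstance) (M : Mem) : List (ℕ → ℝ) :=
  [I.input.real 0, I.input.real 1, I.input.real 2, M.start, M.speed, M.off, M.v, M.f,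
    single M.u, single M.A, single M.V, single M.t]

/-- The state with given instance and working memory. -/
noncomputable def enc (I : RigidInstance) (M : Mem) : State where
  nat a := (natArrays I M).getD a 0
  real a := (realArrays I M).getD a 0

/-- Reads the working memory off a state. -/
def dec (s : State) : Mem where
  B := s.nat 2 0
  rj := s.nat 3
  rlo := s.nat 4
  rhi := s.nat 5
  fr := s.nat 6
  ord := s.nat 7
  slo := s.nat 8
  shi := s.nat 9
  k := s.nat 10 0
  i := s.nat 11 0
  r := s.nat 12 0
  lo := s.nat 13 0
  hi := s.nat 14 0
  c := s.nat 15 0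
  rem := s.nat 16 0
  start := s.real 3
  speed := s.real 4
  off := s.real 5
  v := s.real 6
  f := s.real 7
  u := s.real 8 0
  A := s.real 9 0
  V := s.real 10 0
  t := s.real 11 0

theorem dec_enc (I : RigidInstance) (M : Mem) : dec (enc I M) = M := rfl

/-- The initial working memory. -/
def Mem.init : Mem where
  B := 0
  rj := 0
  rlo := 0
  rhi := 0
  fr := 0
  ord := 0
  slo := 0
  shi := 0
  k := 0
  i := 0
  r := 0
  lo := 0
  hi := 0
  c := 0
  rem := 0
  start := 0
  speed := 0
  off := 0
  v := 0
  f := 0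
  u := 0
  A := 0
  V := 0
  t := 0

theorem single_zero {α : Type} [Zero α] : single (0 : α) = 0 := by
  funext i; simp [single]

theorem update_single {α : Type} [Zero α] (x y : α) :
    Function.update (single x) 0 y = single y := by
  funext i; by_cases h : i = 0 <;> simp [single, h]

/-- Ties the layout to the prescribed input. Both vanish outside the instance data, including all
arrays beyond the last one in the layout. -/
theorem enc_init (I : RigidInstance) : enc I Mem.init = I.input := by
  have hN : ∀ a, 2 ≤ a → I.input.nat a = 0 := by
    intro a ha
    funext i
    have h0 : a ≠ 0 := by omega
    have h1 : a ≠ 1 := by omega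
    simp [RigidInstance.input, h0, h1]
  have hR : ∀ a, 3 ≤ a → I.input.real a = 0 := by
    intro a ha
    funext i
    have h0 : a ≠ 0 := by omega
    have h1 : a ≠ 1 := by omega
    have h2 : a ≠ 2 := by omega
    simp [RigidInstance.input, h0, h1, h2]
  have e1 : (enc I Mem.init).nat = I.input.nat := by
    funext a
    rcases lt_or_ge a 2 with ha | ha
    · interval_cases a <;> rfl
    · rw [hN a ha]
      rcases lt_or_ge a 17 with hb | hb
      · interval_cases a <;> simp [enc, natArrays, Mem.init, single_zero]
      · exact List.getD_eq_default _ _ hb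
  have e2 : (enc I Mem.init).real = I.input.real := by
    funext a
    rcases lt_or_ge a 3 with ha | ha
    · interval_cases a <;> rfl
    · rw [hR a ha]
      rcases lt_or_ge a 12 with hb | hb
      · interval_cases a <;> simp [enc, realArrays, Mem.init, single_zero]
      · exact List.getD_eq_default _ _ hb
  cases h : I.input
  cases h' : enc I Mem.init
  rw [h] at e1 e2
  rw [h'] at e1 e2
  simp_all

theorem update_getD {α : Type} (l : List α) (a : ℕ) (x y : α) (h : a < l.length) :
    Function.update (fun b => l.getD b y) a x = fun b => (l.set a x).getD b y := by
  funext b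
  by_cases hb : b = a
  · subst hb; simp [h]
  · simp [hb, Ne.symm hb]

/-- A write to array `a` replaces one entry of the list of arrays, so the effect of each write on
`Mem` becomes a computation with concrete lists, mostly by `rfl`. -/
theorem writeNat_enc {I : RigidInstance} {M M' : Mem} {a i v : ℕ} (h : a < 17)
    (hn : (natArrays I M).set a (Function.update ((natArrays I M).getD a 0) i v)
      = natArrays I M')
    (hr : realArrays I M = realArrays I M') :
    (enc I M).writeNat a i v = enc I M' := by
  have := update_getD (natArrays I M) a (Function.update ((natArrays I M).getD a 0) i v) 0 h
  simp only [State.writeNat, enc] at this ⊢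
  rw [this, hn, hr]

theorem writeReal_enc {I : RigidInstance} {M M' : Mem} {a i : ℕ} {v : ℝ} (h : a < 12)
    (hr : (realArrays I M).set a (Function.update ((realArrays I M).getD a 0) i v)
      = realArrays I M')
    (hn : natArrays I M = natArrays I M') :
    (enc I M).writeReal a i v = enc I M' := by
  have := update_getD (realArrays I M) a (Function.update ((realArrays I M).getD a 0) i v) 0 h
  simp only [State.writeReal, enc] at this ⊢
  rw [this, hn, hr]

/-! ## Reading and writing variables -/

namespace RigidInstance

variable (I : RigidInstance)

/-- The size of job `j`, for all natural numbers `j`. -/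
def sz (j : ℕ) : ℕ := I.input.nat 1 j
/-- The work of job `j`, for all natural numbers `j`. -/
noncomputable def wk (j : ℕ) : ℝ := I.input.real 0 j
/-- The release time of job `j`, for all natural numbers `j`. -/
noncomputable def rl (j : ℕ) : ℝ := I.input.real 1 j
/-- The deadline of job `j`, for all natural numbers `j`. -/
noncomputable def dl (j : ℕ) : ℝ := I.input.real 2 j
/-- The length of the time window of job `j`. -/
noncomputable def win (j : ℕ) : ℝ := I.dl j - I.rl j

theorem sz_val (j : Fin I.n) : I.sz j = I.size j := by simp [sz, input]
theorem wk_val (j : Fin I.n) : I.wk j = I.work j := by simp [wk, input]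
theorem rl_val (j : Fin I.n) : I.rl j = I.release j := by simp [rl, input]
theorem dl_val (j : Fin I.n) : I.dl j = I.deadline j := by simp [dl, input]

end RigidInstance

/-- Entry `0` of an array of naturals. -/
def nv (a : ℕ) : NatExpr := .read a (.const 0)
/-- Entry `0` of an array of reals. -/
def rv (a : ℕ) : RealExpr := .read a (.const 0)

section Eval

variable (I : RigidInstance) (M : Mem)

theorem eval_n : (nv 0).eval (enc I M) = I.n := rfl
theorem eval_B : (nv 2).eval (enc I M) = M.B := rfl
theorem eval_k : (nv 10).eval (enc I M) = M.k := rfl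
theorem eval_i : (nv 11).eval (enc I M) = M.i := rfl
theorem eval_r : (nv 12).eval (enc I M) = M.r := rfl
theorem eval_lo : (nv 13).eval (enc I M) = M.lo := rfl
theorem eval_hi : (nv 14).eval (enc I M) = M.hi := rfl
theorem eval_c : (nv 15).eval (enc I M) = M.c := rfl
theorem eval_rem : (nv 16).eval (enc I M) = M.rem := rfl
theorem eval_m : (NatExpr.read 0 (.const 1)).eval (enc I M) = I.m := rfl
theorem eval_sz (e : NatExpr) :
    (NatExpr.read 1 e).eval (enc I M) = I.sz (e.eval (enc I M)) := rfl
theorem eval_fr (e : NatExpr) :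
    (NatExpr.read 6 e).eval (enc I M) = M.fr (e.eval (enc I M)) := rfl
theorem eval_ord (e : NatExpr) :
    (NatExpr.read 7 e).eval (enc I M) = M.ord (e.eval (enc I M)) := rfl
theorem eval_slo (e : NatExpr) :
    (NatExpr.read 8 e).eval (enc I M) = M.slo (e.eval (enc I M)) := rfl
theorem eval_shi (e : NatExpr) :
    (NatExpr.read 9 e).eval (enc I M) = M.shi (e.eval (enc I M)) := rfl
theorem eval_wk (e : NatExpr) :
    (RealExpr.read 0 e).eval (enc I M) = I.wk (e.eval (enc I M)) := rfl
theorem eval_rl (e : NatExpr) :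
    (RealExpr.read 1 e).eval (enc I M) = I.rl (e.eval (enc I M)) := rfl
theorem eval_dl (e : NatExpr) :
    (RealExpr.read 2 e).eval (enc I M) = I.dl (e.eval (enc I M)) := rfl
theorem eval_off (e : NatExpr) :
    (RealExpr.read 5 e).eval (enc I M) = M.off (e.eval (enc I M)) := rfl
theorem eval_v (e : NatExpr) :
    (RealExpr.read 6 e).eval (enc I M) = M.v (e.eval (enc I M)) := rfl
theorem eval_f (e : NatExpr) :
    (RealExpr.read 7 e).eval (enc I M) = M.f (e.eval (enc I M)) := rfl
theorem eval_u : (rv 8).eval (enc I M) = M.u := rfl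
theorem eval_A : (rv 9).eval (enc I M) = M.A := rfl
theorem eval_V : (rv 10).eval (enc I M) = M.V := rfl
theorem eval_t : (rv 11).eval (enc I M) = M.t := rfl
theorem eval_nadd (s : State) (x y : NatExpr) : (x.add y).eval s = x.eval s + y.eval s := rfl
theorem eval_nsub (s : State) (x y : NatExpr) : (x.sub y).eval s = x.eval s - y.eval s := rfl
theorem eval_nconst (s : State) (c : ℕ) : (NatExpr.const c).eval s = c := rfl
theorem eval_radd (s : State) (x y : RealExpr) : (x.add y).eval s = x.eval s + y.eval s := rfl
theorem eval_rsub (s : State) (x y : RealExpr) : (x.sub y).eval s = x.eval s - y.eval s := rfl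
theorem eval_rmul (s : State) (x y : RealExpr) : (x.mul y).eval s = x.eval s * y.eval s := rfl
theorem eval_rdiv (s : State) (x y : RealExpr) : (x.div y).eval s = x.eval s / y.eval s := rfl
theorem eval_ofNat (s : State) (e : NatExpr) : (RealExpr.ofNat e).eval s = (e.eval s : ℝ) := rfl

theorem write_B (x : ℕ) : (enc I M).writeNat 2 0 x = enc I { M with B := x } :=
  writeNat_enc (by norm_num) (by simp [natArrays, update_single]) rfl
theorem write_rj (i x : ℕ) :
    (enc I M).writeNat 3 i x = enc I { M with rj := Function.update M.rj i x } :=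
  writeNat_enc (by norm_num) rfl rfl
theorem write_rlo (i x : ℕ) :
    (enc I M).writeNat 4 i x = enc I { M with rlo := Function.update M.rlo i x } :=
  writeNat_enc (by norm_num) rfl rfl
theorem write_rhi (i x : ℕ) :
    (enc I M).writeNat 5 i x = enc I { M with rhi := Function.update M.rhi i x } :=
  writeNat_enc (by norm_num) rfl rfl
theorem write_fr (i x : ℕ) :
    (enc I M).writeNat 6 i x = enc I { M with fr := Function.update M.fr i x } :=
  writeNat_enc (by norm_num) rfl rfl
theorem write_ord (i x : ℕ) :
    (enc I M).writeNat 7 i x = enc I { M with ord := Function.update M.ord i x } :=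
  writeNat_enc (by norm_num) rfl rfl
theorem write_slo (i x : ℕ) :
    (enc I M).writeNat 8 i x = enc I { M with slo := Function.update M.slo i x } :=
  writeNat_enc (by norm_num) rfl rfl
theorem write_shi (i x : ℕ) :
    (enc I M).writeNat 9 i x = enc I { M with shi := Function.update M.shi i x } :=
  writeNat_enc (by norm_num) rfl rfl
theorem write_k (x : ℕ) : (enc I M).writeNat 10 0 x = enc I { M with k := x } :=
  writeNat_enc (by norm_num) (by simp [natArrays, update_single]) rfl
theorem write_i (x : ℕ) : (enc I M).writeNat 11 0 x = enc I { M with i := x } :=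
  writeNat_enc (by norm_num) (by simp [natArrays, update_single]) rfl
theorem write_r (x : ℕ) : (enc I M).writeNat 12 0 x = enc I { M with r := x } :=
  writeNat_enc (by norm_num) (by simp [natArrays, update_single]) rfl
theorem write_lo (x : ℕ) : (enc I M).writeNat 13 0 x = enc I { M with lo := x } :=
  writeNat_enc (by norm_num) (by simp [natArrays, update_single]) rfl
theorem write_hi (x : ℕ) : (enc I M).writeNat 14 0 x = enc I { M with hi := x } :=
  writeNat_enc (by norm_num) (by simp [natArrays, update_single]) rfl
theorem write_c (x : ℕ) : (enc I M).writeNat 15 0 x = enc I { M with c := x } :=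
  writeNat_enc (by norm_num) (by simp [natArrays, update_single]) rfl
theorem write_rem (x : ℕ) : (enc I M).writeNat 16 0 x = enc I { M with rem := x } :=
  writeNat_enc (by norm_num) (by simp [natArrays, update_single]) rfl
theorem write_start (i : ℕ) (x : ℝ) :
    (enc I M).writeReal 3 i x = enc I { M with start := Function.update M.start i x } :=
  writeReal_enc (by norm_num) rfl rfl
theorem write_speed (i : ℕ) (x : ℝ) :
    (enc I M).writeReal 4 i x = enc I { M with speed := Function.update M.speed i x } :=
  writeReal_enc (by norm_num) rfl rfl
theorem write_off (i : ℕ) (x : ℝ) :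
    (enc I M).writeReal 5 i x = enc I { M with off := Function.update M.off i x } :=
  writeReal_enc (by norm_num) rfl rfl
theorem write_v (i : ℕ) (x : ℝ) :
    (enc I M).writeReal 6 i x = enc I { M with v := Function.update M.v i x } :=
  writeReal_enc (by norm_num) rfl rfl
theorem write_f (i : ℕ) (x : ℝ) :
    (enc I M).writeReal 7 i x = enc I { M with f := Function.update M.f i x } :=
  writeReal_enc (by norm_num) rfl rfl
theorem write_u (x : ℝ) : (enc I M).writeReal 8 0 x = enc I { M with u := x } :=
  writeReal_enc (by norm_num) (by simp [realArrays, update_single]) rfl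
theorem write_A (x : ℝ) : (enc I M).writeReal 9 0 x = enc I { M with A := x } :=
  writeReal_enc (by norm_num) (by simp [realArrays, update_single]) rfl
theorem write_V (x : ℝ) : (enc I M).writeReal 10 0 x = enc I { M with V := x } :=
  writeReal_enc (by norm_num) (by simp [realArrays, update_single]) rfl
theorem write_t (x : ℝ) : (enc I M).writeReal 11 0 x = enc I { M with t := x } :=
  writeReal_enc (by norm_num) (by simp [realArrays, update_single]) rfl

end Eval

/-! ## Runs on the working memory -/

/-- Started with the working memory `M`, the program `P` halts after at most `T` steps with a
working memory satisfying `Q`. -/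
def Runs (I : RigidInstance) (P : Program) (M : Mem) (T : ℕ) (Q : Mem → Prop) : Prop :=
  ∃ M' t, Exec P (enc I M) (enc I M') t ∧ t ≤ T ∧ Q M'

/-- The predicate `Q` of the working memory, on states. -/
def Post (I : RigidInstance) (Q : Mem → Prop) (s : State) : Prop := s = enc I (dec s) ∧ Q (dec s)

theorem post_enc (I : RigidInstance) (Q : Mem → Prop) (M : Mem) : Post I Q (enc I M) ↔ Q M := by
  simp [Post, dec_enc]

theorem Runs.mono {I : RigidInstance} {P : Program} {M : Mem} {T T' : ℕ} {Q Q' : Mem → Prop}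
    (h : Runs I P M T Q) (hT : T ≤ T') (hQ : ∀ M', Q M' → Q' M') : Runs I P M T' Q' := by
  obtain ⟨M', t, h1, h2, h3⟩ := h
  exact ⟨M', t, h1, h2.trans hT, hQ _ h3⟩

/-- `Post` demands that the final state is again an encoding; this is what lets runs be chained on
`Mem` alone. -/
theorem Runs.of_wp {I : RigidInstance} {P : Program} {M : Mem} {T : ℕ} {Q : Mem → Prop}
    (h : P.wp (Post I Q) (enc I M)) (hT : P.bound ≤ T) : Runs I P M T Q := by
  obtain ⟨s, t, h1, h2, h3, h4⟩ := P.exec_of_wp _ _ h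
  exact ⟨dec s, t, h3 ▸ h1, h2.trans hT, h4⟩

theorem Runs.seq {I : RigidInstance} {P R : Program} {M : Mem} {T T' : ℕ} {Q Q' : Mem → Prop}
    (hP : Runs I P M T Q) (hR : ∀ M', Q M' → Runs I R M' T' Q') :
    Runs I (.seq P R) M (T + T') Q' := by
  obtain ⟨M', t, h1, h2, h3⟩ := hP
  obtain ⟨M'', t', h4, h5, h6⟩ := hR M' h3
  exact ⟨M'', t + t', .seq h1 h4, Nat.add_le_add h2 h5, h6⟩

theorem Runs.cond {I : RigidInstance} {b : Cond} {P R : Program} {M : Mem} {T : ℕ}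
    {Q : Mem → Prop} (hP : b.Holds (enc I M) → Runs I P M T Q)
    (hR : ¬ b.Holds (enc I M) → Runs I R M T Q) : Runs I (.cond b P R) M (b.cost + T) Q := by
  by_cases hb : b.Holds (enc I M)
  · obtain ⟨M', t, h1, h2, h3⟩ := hP hb
    exact ⟨M', _, .condTrue hb h1, by omega, h3⟩
  · obtain ⟨M', t, h1, h2, h3⟩ := hR hb
    exact ⟨M', _, .condFalse hb h1, by omega, h3⟩

/-- The loop rule: `Inv N M` holds if the invariant holds and at most `N` iterations remain. -/
theorem Runs.loop {I : RigidInstance} {b : Cond} {P : Program} {T : ℕ} (Inv : ℕ → Mem → Prop)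
    (step : ∀ N M, Inv N M → b.Holds (enc I M) →
      Runs I P M T (fun M' => ∃ N' < N, Inv N' M')) :
    ∀ N M, Inv N M → Runs I (.loop b P) M (N * (b.cost + T) + b.cost)
      (fun M' => (∃ N', Inv N' M') ∧ ¬ b.Holds (enc I M')) := by
  intro N
  induction N using Nat.strong_induction_on with
  | _ N ih =>
    intro M hM
    by_cases hb : b.Holds (enc I M)
    · obtain ⟨M', t, h1, h2, N', hN', h3⟩ := step N M hM hb
      obtain ⟨M'', t', h4, h5, h6⟩ := ih N' hN' M' h3
      refine ⟨M'', _, .loopStep hb h1 h4, ?_, h6⟩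
      have : (N' + 1) * (b.cost + T) ≤ N * (b.cost + T) := Nat.mul_le_mul_right _ hN'
      rw [Nat.add_mul, Nat.one_mul] at this
      omega
    · exact ⟨M, _, .loopDone hb, by omega, ⟨N, hM⟩, hb⟩

theorem holds_natLt {s : State} {x y : NatExpr} :
    (Cond.natLt x y).Holds s ↔ x.eval s < y.eval s := Iff.rfl
theorem holds_natEq {s : State} {x y : NatExpr} :
    (Cond.natEq x y).Holds s ↔ x.eval s = y.eval s := Iff.rfl
theorem holds_realLt {s : State} {x y : RealExpr} :
    (Cond.realLt x y).Holds s ↔ x.eval s < y.eval s := Iff.rfl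
theorem holds_realLe {s : State} {x y : RealExpr} :
    (Cond.realLe x y).Holds s ↔ x.eval s ≤ y.eval s := Iff.rfl

attribute [simp] eval_n eval_B eval_k eval_i eval_r eval_lo eval_hi eval_c eval_rem eval_m
  eval_sz eval_fr eval_ord eval_slo eval_shi eval_wk eval_rl eval_dl eval_off eval_v eval_f
  eval_u eval_A eval_V eval_t eval_nadd eval_nsub eval_nconst eval_radd eval_rsub eval_rmul
  eval_rdiv eval_ofNat write_B write_rj write_rlo write_rhi write_fr write_ord write_slo
  write_shi write_k write_i write_r write_lo write_hi write_c write_rem write_start write_speed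
  write_off write_v write_f write_u write_A write_V write_t post_enc
  holds_natLt holds_natEq holds_realLt holds_realLe Program.wp

/-! ## Sorting by the lengths of the time windows -/

/-- Job `i` precedes job `j` in the order of the window lengths. -/
def RigidInstance.Before (I : RigidInstance) (i j : ℕ) : Prop :=
  I.win i < I.win j ∨ (I.win i = I.win j ∧ i < j)

open Classical in
/-- The number of jobs `i < b` that precede job `j`. -/
noncomputable def RigidInstance.rank (I : RigidInstance) (b j : ℕ) : ℕ :=
  ((Finset.range b).filter (I.Before · j)).card

theorem RigidInstance.rank_succ_of_before {I : RigidInstance} {b j : ℕ} (h : I.Before b j) :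
    I.rank (b + 1) j = I.rank b j + 1 := by
  classical
  simp [rank, Finset.range_add_one, Finset.filter_insert, h]

theorem RigidInstance.rank_succ_of_not_before {I : RigidInstance} {b j : ℕ}
    (h : ¬ I.Before b j) : I.rank (b + 1) j = I.rank b j := by
  classical
  simp [rank, Finset.range_add_one, Finset.filter_insert, h]

theorem RigidInstance.Before.trans {I : RigidInstance} {i j k : ℕ} (h : I.Before i j)
    (h' : I.Before j k) : I.Before i k := by
  rcases h with h | ⟨h, hl⟩ <;> rcases h' with h' | ⟨h', hl'⟩
  · exact Or.inl (h.trans h')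
  · exact Or.inl (h.trans_eq h')
  · exact Or.inl (h ▸ h')
  · exact Or.inr ⟨h.trans h', hl.trans hl'⟩

theorem RigidInstance.not_before_self (I : RigidInstance) (i : ℕ) : ¬ I.Before i i := by
  rintro (h | ⟨_, h⟩) <;> exact lt_irrefl _ h

theorem RigidInstance.before_or_before {I : RigidInstance} {i j : ℕ} (h : i ≠ j) :
    I.Before i j ∨ I.Before j i := by
  rcases lt_trichotomy (I.win i) (I.win j) with h1 | h1 | h1
  · exact Or.inl (Or.inl h1)
  · rcases lt_or_gt_of_ne h with h2 | h2
    · exact Or.inl (Or.inr ⟨h1, h2⟩)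
    · exact Or.inr (Or.inr ⟨h1.symm, h2⟩)
  · exact Or.inr (Or.inl h1)

/-- By transitivity the predecessors of `i` precede `j`, and `i` is one more. As ties are broken by
the index, distinct jobs therefore get distinct ranks. -/
theorem RigidInstance.rank_lt_rank {I : RigidInstance} {n i j : ℕ} (hi : i < n)
    (h : I.Before i j) : I.rank n i < I.rank n j := by
  classical
  refine Finset.card_lt_card ((Finset.ssubset_iff_of_subset ?_).2 ⟨i, ?_, ?_⟩)
  · intro l hl
    simp only [Finset.mem_filter] at hl ⊢
    exact ⟨hl.1, hl.2.trans h⟩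
  · simp [hi, h]
  · simp [I.not_before_self]

theorem RigidInstance.rank_lt {I : RigidInstance} {n j : ℕ} (hj : j < n) : I.rank n j < n := by
  classical
  have : I.rank n j < (Finset.range n).card :=
    Finset.card_lt_card ((Finset.ssubset_iff_of_subset (Finset.filter_subset _ _)).2
      ⟨j, by simp [hj], by simp [I.not_before_self]⟩)
  simpa using this

/-- The array `o` lists the jobs by increasing lengths of the time windows. -/
structure Sorted (I : RigidInstance) (o : ℕ → ℕ) : Prop where
  lt : ∀ k < I.n, o k < I.n
  inj : ∀ k < I.n, ∀ l < I.n, o k = o l → k = l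
  surj : ∀ j < I.n, ∃ k < I.n, o k = j
  mono : ∀ k l, k ≤ l → l < I.n → I.win (o k) ≤ I.win (o l)

/-- The ranks are distinct numbers below `n`, hence a permutation by finiteness, and `o` is its
inverse. -/
theorem sorted_of_rank {I : RigidInstance} {o : ℕ → ℕ}
    (h : ∀ j < I.n, o (I.rank I.n j) = j) : Sorted I o := by
  have inj : Function.Injective fun j : Fin I.n => (⟨I.rank I.n j, I.rank_lt j.2⟩ : Fin I.n) := by
    intro i j hij
    have hij : I.rank I.n i = I.rank I.n j := congrArg Fin.val hij
    by_contra hne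
    rcases I.before_or_before (fun e => hne (Fin.ext e)) with hb | hb
    · exact (RigidInstance.rank_lt_rank i.2 hb).ne hij
    · exact (RigidInstance.rank_lt_rank j.2 hb).ne hij.symm
  have surj := Finite.surjective_of_injective inj
  have key : ∀ k < I.n, o k < I.n ∧ I.rank I.n (o k) = k := by
    intro k hk
    obtain ⟨j, hj⟩ := surj ⟨k, hk⟩
    have hj : I.rank I.n j = k := congrArg Fin.val hj
    have := h j j.2
    rw [hj] at this
    rw [this]
    exact ⟨j.2, hj⟩
  refine ⟨fun k hk => (key k hk).1, ?_, ?_, ?_⟩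
  · intro k hk l hl hkl
    rw [← (key k hk).2, ← (key l hl).2, hkl]
  · exact fun j hj => ⟨_, I.rank_lt hj, h j hj⟩
  · intro k l hkl hl
    by_contra hlt
    have := RigidInstance.rank_lt_rank (key l hl).1 (Or.inl (not_le.1 hlt))
    rw [(key l hl).2, (key k (hkl.trans_lt hl)).2] at this
    omega

/-- The length of the time window of a job. -/
def winExpr (e : NatExpr) : RealExpr := .sub (.read 2 e) (.read 1 e)

@[simp] theorem eval_winExpr (I : RigidInstance) (M : Mem) (e : NatExpr) :
    (winExpr e).eval (enc I M) = I.win (e.eval (enc I M)) := rfl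

/-- Adds one to entry `0` of an array of naturals. -/
def incr (a : ℕ) : Program := .assignNat a (.const 0) (.add (nv a) (.const 1))

/-- Sets entry `0` of an array of naturals. -/
def setN (a : ℕ) (e : NatExpr) : Program := .assignNat a (.const 0) e

/-- Sets entry `0` of an array of reals. -/
def setR (a : ℕ) (e : RealExpr) : Program := .assignReal a (.const 0) e

@[simp] theorem wp_incr (a : ℕ) (Q : State → Prop) (s : State) :
    (incr a).wp Q s ↔ Q (s.writeNat a 0 ((nv a).eval s + 1)) := Iff.rfl
@[simp] theorem wp_setN (a : ℕ) (e : NatExpr) (Q : State → Prop) (s : State) :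
    (setN a e).wp Q s ↔ Q (s.writeNat a 0 (e.eval s)) := Iff.rfl
@[simp] theorem wp_setR (a : ℕ) (e : RealExpr) (Q : State → Prop) (s : State) :
    (setR a e).wp Q s ↔ Q (s.writeReal a 0 (e.eval s)) := Iff.rfl

/-- One comparison of the rank computation. -/
def rankBody : Program :=
  .seq (.cond (.realLt (winExpr (nv 11)) (winExpr (nv 10))) (incr 12)
    (.cond (.realLt (winExpr (nv 10)) (winExpr (nv 11))) .skip
      (.cond (.natLt (nv 11) (nv 10)) (incr 12) .skip)))
    (incr 11)

/-- Computes the rank of job `k` and stores the job there. -/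
def sortBody : Program :=
  .seq (.seq (setN 12 (.const 0)) (setN 11 (.const 0)))
    (.seq (.loop (.natLt (nv 11) (nv 0)) rankBody)
      (.seq (.assignNat 7 (nv 12) (nv 10)) (incr 10)))

/-- Sorts the jobs by the lengths of their time windows. -/
def sortProg : Program := .seq (setN 10 (.const 0)) (.loop (.natLt (nv 10) (nv 0)) sortBody)

/-! ### Correctness of the sorting program. -/

theorem runs_rankBody (I : RigidInstance) (M : Mem) (hr : M.r = I.rank M.i M.k) :
    Runs I rankBody M 60 fun M' => M' = { M with i := M.i + 1, r := I.rank (M.i + 1) M.k } := by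
  refine Runs.of_wp ?_ (by decide)
  simp only [rankBody, Program.wp, wp_incr, holds_realLt, eval_winExpr, eval_i, eval_k, eval_r,
    write_r, write_i, post_enc, holds_natLt, Mem.mk.injEq, true_and, and_true]
  have h1 : I.Before M.i M.k → I.rank (M.i + 1) M.k = M.r + 1 := fun h => by
    rw [RigidInstance.rank_succ_of_before h, hr]
  have h2 : ¬ I.Before M.i M.k → M.r = I.rank (M.i + 1) M.k := fun h => by
    rw [RigidInstance.rank_succ_of_not_before h, hr]
  refine ⟨fun h => ?_, fun h => ⟨fun h' => ?_, fun h' => ⟨fun h'' => ?_, fun h'' => ?_⟩⟩⟩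
  · rw [h1 (Or.inl h)]
  · rw [h2]; rintro (h3 | h3)
    · exact h h3
    · exact h'.ne h3.1.symm
  · rw [h1 (Or.inr ⟨le_antisymm (not_lt.1 h') (not_lt.1 h), h''⟩)]
  · rw [h2]; rintro (h3 | h3)
    · exact h h3
    · exact h'' h3.2

theorem runs_rankLoop (I : RigidInstance) (M : Mem) (hi : M.i = 0) (hr : M.r = 0) :
    Runs I (.loop (.natLt (nv 11) (nv 0)) rankBody) M (70 * I.n + 10) fun M' =>
      M' = { M with i := I.n, r := I.rank I.n M.k } := by
  refine Runs.mono (Runs.loop (T := 60)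
    (fun N M' => ∃ i ≤ I.n, N = I.n - i ∧ M' = { M with i := i, r := I.rank i M.k })
    ?_ I.n M ⟨0, Nat.zero_le _, rfl, ?_⟩) ?_ ?_
  · rintro N M' ⟨i, hi, rfl, rfl⟩ hb
    simp only [holds_natLt, eval_i, eval_n] at hb
    refine Runs.mono (runs_rankBody I _ rfl) le_rfl ?_
    rintro M'' rfl
    exact ⟨I.n - (i + 1), by omega, i + 1, hb, rfl, rfl⟩
  · cases M; simp_all [RigidInstance.rank]
  · have : (Cond.natLt (nv 11) (nv 0)).cost = 5 := rfl
    rw [this]; omega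
  · rintro M' ⟨⟨N, i, hi, rfl, rfl⟩, hb⟩
    simp only [holds_natLt, eval_i, eval_n] at hb
    obtain rfl : i = I.n := by omega
    rfl

theorem runs_sortBody (I : RigidInstance) (M : Mem) :
    Runs I sortBody M (70 * I.n + 40) fun M' =>
      M' = { M with
        i := I.n, r := I.rank I.n M.k, k := M.k + 1
        ord := Function.update M.ord (I.rank I.n M.k) M.k } := by
  refine Runs.mono (Runs.seq (T := 10) (Q := fun M' => M' = { M with r := 0, i := 0 })
    (Runs.of_wp (by simp) (by decide)) (T' := 70 * I.n + 10 + 20) ?_) (by omega) (fun _ h => h)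
  rintro M' rfl
  refine Runs.seq (runs_rankLoop I _ rfl rfl) ?_
  rintro M' rfl
  exact Runs.of_wp (by simp) (by decide)

theorem runs_sortProg (I : RigidInstance) (M : Mem) :
    Runs I sortProg M (4 + I.n * (5 + (70 * I.n + 40)) + 5) fun M' =>
      Sorted I M'.ord ∧ M'.fr = M.fr := by
  refine Runs.mono (Runs.seq (T := 4) (Q := fun M' => M' = { M with k := 0 })
    (Runs.of_wp (by simp) (by decide)) (T' := I.n * (5 + (70 * I.n + 40)) + 5) ?_)
    (by omega) (fun _ h => h)
  rintro M' rfl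
  refine Runs.mono (Runs.loop (T := 70 * I.n + 40)
    (fun N M' => M'.k ≤ I.n ∧ N = I.n - M'.k ∧ M'.fr = M.fr ∧
      ∀ j < M'.k, M'.ord (I.rank I.n j) = j)
    ?_ I.n _ ⟨Nat.zero_le _, rfl, rfl, by simp⟩) le_rfl ?_
  · rintro N M' ⟨hk, rfl, hfr, ho⟩ hb
    simp only [holds_natLt, eval_k, eval_n] at hb
    refine Runs.mono (runs_sortBody I M') le_rfl ?_
    rintro M'' rfl
    refine ⟨I.n - (M'.k + 1), by omega, hb, rfl, hfr, ?_⟩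
    intro j hj
    rcases Nat.lt_succ_iff_lt_or_eq.1 hj with hj | rfl
    · simp only [Function.update_apply]
      -- Distinct ranks: the new entry does not overwrite an earlier one.
      have hne : I.rank I.n j ≠ I.rank I.n M'.k := by
        rcases I.before_or_before (i := j) (j := M'.k) hj.ne with h | h
        · exact (RigidInstance.rank_lt_rank (hj.trans hb) h).ne
        · exact (RigidInstance.rank_lt_rank hb h).ne'
      rw [if_neg hne, ho j hj]
    · simp
  · rintro M' ⟨⟨N, hk, _, hfr, ho⟩, hb⟩
    simp only [holds_natLt, eval_k, eval_n] at hb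
    have : M'.k = I.n := by omega
    rw [this] at ho
    exact ⟨sorted_of_rank ho, hfr⟩

/-! ## Optimal durations -/

/-- The sizes, works and window lengths of jobs sorted by their window lengths. -/
structure JobData where
  n : ℕ
  m : ℕ
  z : ℕ → ℕ
  w : ℕ → ℝ
  d : ℕ → ℝ

/-- The conditions on the data of an instance with small jobs. -/
structure JobData.Valid (J : JobData) : Prop where
  z_pos : ∀ j < J.n, 0 < J.z j
  z_le : ∀ j < J.n, 2 * J.z j ≤ J.m
  w_pos : ∀ j < J.n, 0 < J.w j
  d_pos : ∀ j < J.n, 0 < J.d j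

/-- The load conditions that the durations `q` of the jobs in a feasible schedule satisfy. -/
structure JobData.Durations (J : JobData) (q : ℕ → ℝ) : Prop where
  le : ∀ j < J.n, q j ≤ J.d j
  chain : ∀ k < J.n, ∑ j ∈ Finset.range (k + 1), (J.z j : ℝ) * q j ≤ J.m * J.d k

/-- The duration of job `j` if the frozen jobs have the speeds `v` and the others the speed `x`. -/
noncomputable def JobData.dur (J : JobData) (fr : ℕ → ℕ) (v : ℕ → ℝ) (x : ℝ) (j : ℕ) : ℝ :=
  J.w j / if fr j = 0 then x else v j

/-- The load of the frozen jobs below `k`. -/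
noncomputable def JobData.load (J : JobData) (fr : ℕ → ℕ) (v : ℕ → ℝ) (k : ℕ) : ℝ :=
  ∑ j ∈ Finset.range k, if fr j = 0 then 0 else (J.z j : ℝ) * (J.w j / v j)

/-- The volume of the unfrozen jobs below `k`. -/
noncomputable def JobData.vol (J : JobData) (fr : ℕ → ℕ) (k : ℕ) : ℝ :=
  ∑ j ∈ Finset.range k, if fr j = 0 then (J.z j : ℝ) * J.w j else 0

/-- The level `x` enters a load constraint only through the volume of the unfrozen jobs, so a scan
can test the constraint with two running sums. -/
theorem JobData.sum_dur (J : JobData) (fr : ℕ → ℕ) (v : ℕ → ℝ) (x : ℝ) (k : ℕ) :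
    ∑ j ∈ Finset.range k, (J.z j : ℝ) * J.dur fr v x j = J.load fr v k + J.vol fr k / x := by
  rw [load, vol, Finset.sum_div, ← Finset.sum_add_distrib]
  refine Finset.sum_congr rfl fun j _ => ?_
  by_cases h : fr j = 0 <;> simp [dur, h, mul_div_assoc]

/-- The excess of the durations `q` over those of the frozen jobs, weighted by `g`. -/
noncomputable def JobData.excess (J : JobData) (fr : ℕ → ℕ) (v g q : ℕ → ℝ) : ℝ :=
  ∑ j ∈ Finset.range J.n, if fr j = 0 then 0 else (J.z j : ℝ) * g j * (q j - J.w j / v j)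

/-- The invariant of the computation of the speeds at the level `L`. -/
structure FreezeInv (J : JobData) (fr : ℕ → ℕ) (v : ℕ → ℝ) (L : ℝ) : Prop where
  pos : 0 < L
  level : ∀ j < J.n, fr j ≠ 0 → L ≤ v j
  window : ∀ j < J.n, J.dur fr v L j ≤ J.d j
  chain : ∀ k < J.n, J.load fr v (k + 1) + J.vol fr (k + 1) / L ≤ J.m * J.d k
  cap : ∀ j < J.n, fr j ≠ 0 → ∀ i ≤ j, fr i = 0 → J.w j / v j = J.d j
  excess_nonpos : ∀ q, J.Durations q → J.excess fr v 1 q ≤ 0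
  opt : ∀ q, J.Durations q → ∀ a : ℝ, 0 < a →
    J.excess fr v (fun j => v j ^ a) q ≤ L ^ a * J.excess fr v 1 q

theorem JobData.vol_nonneg {J : JobData} (hJ : J.Valid) (fr : ℕ → ℕ) {k : ℕ} (hk : k ≤ J.n) :
    0 ≤ J.vol fr k := by
  refine Finset.sum_nonneg fun j hj => ?_
  have := hJ.w_pos j ((Finset.mem_range.1 hj).trans_le hk)
  split_ifs <;> positivity

/-- At a high enough level all constraints hold, and with nothing frozen the excess conditions
concern empty sums. -/
theorem exists_freezeInv {J : JobData} (hJ : J.Valid) (v : ℕ → ℝ) :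
    ∃ L, FreezeInv J (fun _ => 0) v L := by
  have h1 : ∃ L : ℝ, 0 < L ∧ (∀ j ∈ Finset.range J.n, J.w j / J.d j ≤ L) ∧
      ∀ k ∈ Finset.range J.n, J.vol (fun _ => 0) (k + 1) / (J.m * J.d k) ≤ L := by
    obtain ⟨L1, h1⟩ := ((Finset.range J.n).image fun j => J.w j / J.d j).bddAbove
    obtain ⟨L2, h2⟩ := ((Finset.range J.n).image fun k =>
      J.vol (fun _ => 0) (k + 1) / (J.m * J.d k)).bddAbove
    -- The 1 makes the level positive even without jobs.
    refine ⟨max 1 (max L1 L2), by positivity, fun j hj => ?_, fun j hj => ?_⟩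
    · exact (h1 (by exact_mod_cast Finset.mem_image_of_mem _ hj)).trans (by simp)
    · exact (h2 (by exact_mod_cast Finset.mem_image_of_mem _ hj)).trans (by simp)
  obtain ⟨L, hL, h1, h2⟩ := h1
  refine ⟨L, hL, by simp, fun j hj => ?_, fun k hk => ?_, by simp, by simp [JobData.excess],
    by simp [JobData.excess]⟩
  · have := h1 j (Finset.mem_range.2 hj)
    rw [div_le_iff₀ (hJ.d_pos j hj)] at this
    simp only [JobData.dur, if_true]
    rw [div_le_iff₀ hL]; linarith
  · have := h2 k (Finset.mem_range.2 hk)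
    have hm : (0 : ℝ) < J.m := by
      have h3 := hJ.z_pos k hk
      have h4 := hJ.z_le k hk
      exact_mod_cast (by omega : 0 < J.m)
    rw [div_le_iff₀ (mul_pos hm (hJ.d_pos k hk))] at this
    have h0 : J.load (fun _ => 0) v (k + 1) = 0 := by simp [JobData.load]
    rw [h0, zero_add, div_le_iff₀ hL]; linarith

theorem FreezeInv.load_le {J : JobData} (hJ : J.Valid) {fr : ℕ → ℕ} {v : ℕ → ℝ} {L : ℝ}
    (h : FreezeInv J fr v L) {k : ℕ} (hk : k < J.n) : J.load fr v (k + 1) ≤ J.m * J.d k := by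
  have h1 := h.chain k hk
  have h2 := div_nonneg (J.vol_nonneg hJ fr (k := k + 1) hk) h.pos.le
  linarith

/-- What one scan of the jobs `< k` computes. -/
structure ScanInv (J : JobData) (fr : ℕ → ℕ) (v : ℕ → ℝ) (k : ℕ) (u : ℝ) (lo hi : ℕ) :
    Prop where
  job : ∀ i < k, fr i = 0 → J.w i ≤ u * J.d i
  chain : ∀ i < k, J.vol fr (i + 1) ≤ u * (J.m * J.d i - J.load fr v (i + 1))
  attained : (hi = 0 ∧ lo = 0 ∧ u = 0 ∧ ∀ i < k, fr i ≠ 0) ∨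
    (0 < u ∧ ∃ i < k, hi = i + 1 ∧ ((lo = i ∧ fr i = 0 ∧ J.w i = u * J.d i) ∨
      (lo = 0 ∧ 0 < J.vol fr (i + 1) ∧
        J.vol fr (i + 1) = u * (J.m * J.d i - J.load fr v (i + 1)))))

theorem ScanInv.zero (J : JobData) (fr : ℕ → ℕ) (v : ℕ → ℝ) : ScanInv J fr v 0 0 0 0 :=
  ⟨by simp, by simp, by simp⟩

theorem ScanInv.nonneg {J : JobData} {fr : ℕ → ℕ} {v : ℕ → ℝ} {k lo hi : ℕ} {u : ℝ}
    (h : ScanInv J fr v k u lo hi) : 0 ≤ u := by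
  rcases h.attained with h | h
  · exact h.2.2.1.ge
  · exact h.1.le

/-- The level already satisfies the constraints at `k` and stays the largest one met. The demand `0
< u` for an unfrozen job excludes the initial alternative of `attained`, which claims that all jobs
met are frozen. -/
theorem ScanInv.keep {J : JobData} {fr : ℕ → ℕ} {v : ℕ → ℝ} {k lo hi : ℕ} {u : ℝ}
    (h : ScanInv J fr v k u lo hi) (hj : fr k = 0 → 0 < u ∧ J.w k ≤ u * J.d k)
    (hc : J.vol fr (k + 1) ≤ u * (J.m * J.d k - J.load fr v (k + 1))) :
    ScanInv J fr v (k + 1) u lo hi := by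
  refine ⟨fun i hi hf => ?_, fun i hi => ?_, ?_⟩
  · rcases Nat.lt_succ_iff_lt_or_eq.1 hi with hi | rfl
    · exact h.job i hi hf
    · exact (hj hf).2
  · rcases Nat.lt_succ_iff_lt_or_eq.1 hi with hi | rfl
    · exact h.chain i hi
    · exact hc
  · rcases h.attained with ⟨h1, h2, h3, h4⟩ | ⟨h1, i, hi, h2⟩
    · refine Or.inl ⟨h1, h2, h3, fun i hi => ?_⟩
      rcases Nat.lt_succ_iff_lt_or_eq.1 hi with hi | rfl
      · exact h4 i hi
      · exact fun hf => (hj hf).1.ne' h3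
    · exact Or.inr ⟨h1, i, hi.trans (Nat.lt_succ_self _), h2⟩

/-- A higher level keeps the earlier constraints, because windows are positive and the slacks m d_i
- load are nonnegative by the old invariant. -/
theorem ScanInv.raise {J : JobData} (hJ : J.Valid) {fr : ℕ → ℕ} {v : ℕ → ℝ} {L : ℝ}
    (hI : FreezeInv J fr v L) {k lo hi lo' : ℕ} {u u' : ℝ} (hk : k < J.n)
    (h : ScanInv J fr v k u lo hi) (hu : u < u') (hj : fr k = 0 → J.w k ≤ u' * J.d k)
    (hc : J.vol fr (k + 1) ≤ u' * (J.m * J.d k - J.load fr v (k + 1)))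
    (ha : (lo' = k ∧ fr k = 0 ∧ J.w k = u' * J.d k) ∨
      (lo' = 0 ∧ 0 < J.vol fr (k + 1) ∧
        J.vol fr (k + 1) = u' * (J.m * J.d k - J.load fr v (k + 1)))) :
    ScanInv J fr v (k + 1) u' lo' (k + 1) := by
  refine ⟨fun i hi hf => ?_, fun i hi => ?_, Or.inr ⟨h.nonneg.trans_lt hu, k, Nat.lt_succ_self k,
    rfl, ha⟩⟩
  · rcases Nat.lt_succ_iff_lt_or_eq.1 hi with hi | rfl
    · refine (h.job i hi hf).trans ?_
      exact mul_le_mul_of_nonneg_right hu.le (hJ.d_pos i (hi.trans hk)).le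
    · exact hj hf
  · rcases Nat.lt_succ_iff_lt_or_eq.1 hi with hi | rfl
    · refine (h.chain i hi).trans (mul_le_mul_of_nonneg_right hu.le ?_)
      have := hI.load_le hJ (hi.trans hk)
      linarith
    · exact hc

/-- One round of the water-filling argument. A newly frozen job has at speed `u` the duration that
it would have unfrozen at level `u`, so all window and load constraints come from the scan. The
optimality condition follows by one step of Abel summation from the level `L` to the lower level
`u`. -/
theorem FreezeInv.freeze {J : JobData} (hJ : J.Valid) {fr fr' : ℕ → ℕ} {v v' : ℕ → ℝ} {L u : ℝ}
    (h : FreezeInv J fr v L) {lo hi : ℕ} (hs : ScanInv J fr v J.n u lo hi) (h0 : 0 < hi)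
    (hfr : ∀ j, fr' j = if lo ≤ j ∧ j < hi ∧ fr j = 0 then 1 else fr j)
    (hv : ∀ j, v' j = if lo ≤ j ∧ j < hi ∧ fr j = 0 then u else v j) :
    FreezeInv J fr' v' u ∧ ∃ j < J.n, fr j = 0 ∧ fr' j ≠ 0 := by
  obtain ⟨hu, i, hi', rfl, hatt⟩ := hs.attained.resolve_left (fun h => by omega)
  have hdi := hJ.d_pos i hi'
  -- The constraint that determines `u` also held at level `L`, so the level cannot rise.
  have huL : u ≤ L := by
    rcases hatt with ⟨_, hf, hw⟩ | ⟨_, hvol, hw⟩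
    · have := h.window i hi'
      rw [JobData.dur, if_pos hf, div_le_iff₀ h.pos] at this
      by_contra hlt
      nlinarith [mul_lt_mul_of_pos_right (not_le.1 hlt) hdi]
    · have h1 := h.chain i hi'
      have h2 : J.vol fr (i + 1) / L ≤ J.m * J.d i - J.load fr v (i + 1) := by linarith
      rw [div_le_iff₀ h.pos] at h2
      have h3 : 0 < J.m * J.d i - J.load fr v (i + 1) :=
        pos_of_mul_pos_right (hw ▸ hvol) hu.le
      rw [hw, mul_comm] at h2
      exact le_of_mul_le_mul_left h2 h3
  have hold : ∀ j, fr j ≠ 0 → fr' j ≠ 0 ∧ v' j = v j := by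
    intro j hj
    simp [hfr, hv, hj]
  have hnew : ∀ j, fr j = 0 → fr' j ≠ 0 → v' j = u := by
    intro j hj hj'
    rw [hfr] at hj'
    rw [hv]
    split_ifs at hj' ⊢ with hc
    · rfl
    · exact absurd hj hj'
  have hunf : ∀ j, fr' j = 0 → fr j = 0 := by
    intro j hj
    by_contra hne
    exact (hold j hne).1 hj
  have hdur : ∀ j, J.dur fr' v' u j = J.dur fr v u j := by
    intro j
    by_cases hj : fr j = 0
    · by_cases hj' : fr' j = 0
      · simp [JobData.dur, hj, hj']
      · simp [JobData.dur, hj, hj', hnew j hj hj']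
    · simp [JobData.dur, hj, (hold j hj).1, (hold j hj).2]
  have hsum : ∀ k < J.n, ∑ j ∈ Finset.range (k + 1), (J.z j : ℝ) * J.dur fr' v' u j
      = J.load fr v (k + 1) + J.vol fr (k + 1) / u := by
    intro k _
    rw [← J.sum_dur]
    exact Finset.sum_congr rfl fun j _ => by rw [hdur]
  -- A tight window adds the single term of a job of duration d_j, which is nonpositive. At a tight
  -- load constraint `i`, all jobs up to `i` are frozen with total load exactly m d_i, which no
  -- admissible `q` exceeds; the frozen jobs beyond `i` fill their windows.
  have hexcess : ∀ q, J.Durations q → J.excess fr' v' 1 q ≤ 0 := by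
    intro q hq
    rcases hatt with ⟨rfl, hf, hw⟩ | ⟨rfl, hvol, hw⟩
    · refine le_trans ?_ (h.excess_nonpos q hq)
      refine Finset.sum_le_sum fun j hj => ?_
      have hjn := Finset.mem_range.1 hj
      by_cases hj : fr j = 0
      · by_cases hj' : fr' j = 0
        · simp [hj, hj']
        · rw [if_pos hj, if_neg hj', hnew j hj hj']
          have hji : j = lo := by
            rw [hfr] at hj'
            split_ifs at hj' with hc
            · omega
            · exact absurd hj hj'
          subst hji
          have : J.w j / u = J.d j := by rw [hw]; field_simp
          rw [this]
          have := hq.le j hjn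
          refine mul_nonpos_of_nonneg_of_nonpos (by simp) (by linarith)
      · simp [hj, (hold j hj).1, (hold j hj).2]
    -- Positive volume comes from an unfrozen job up to `i`, which makes `cap` applicable to every
    -- frozen job beyond `i`.
    · obtain ⟨j0, hj0, hj0'⟩ : ∃ j0 ≤ i, fr j0 = 0 := by
        by_contra hcon
        push Not at hcon
        refine hvol.ne' (Finset.sum_eq_zero fun j hj => if_neg (hcon j ?_))
        have := Finset.mem_range.1 hj
        omega
      have hsplit : J.excess fr' v' 1 q ≤
          ∑ j ∈ Finset.range (i + 1), (J.z j : ℝ) * (q j - J.dur fr' v' u j) := by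
        rw [JobData.excess, ← Finset.sum_range_add_sum_Ico _ (Nat.succ_le_of_lt hi')]
        have h1 : ∀ j ∈ Finset.range (i + 1),
            (if fr' j = 0 then 0 else (J.z j : ℝ) * (1 : ℕ → ℝ) j * (q j - J.w j / v' j))
              = (J.z j : ℝ) * (q j - J.dur fr' v' u j) := by
          intro j hj
          have hj := Finset.mem_range.1 hj
          have hne : fr' j ≠ 0 := by
            rw [hfr]
            split_ifs with hc
            · exact one_ne_zero
            · exact fun h0 => hc ⟨Nat.zero_le _, hj, h0⟩
          simp [hne, JobData.dur]
        rw [Finset.sum_congr rfl h1]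
        refine add_le_of_nonpos_right (Finset.sum_nonpos fun j hj => ?_)
        have hj := Finset.mem_Ico.1 hj
        by_cases hj' : fr' j = 0
        · simp [hj']
        · rw [if_neg hj']
          have hfj : fr j ≠ 0 := by
            rw [hfr, if_neg (by omega)] at hj'
            exact hj'
          rw [(hold j hfj).2, h.cap j hj.2 hfj j0 (by omega) hj0']
          have := hq.le j hj.2
          exact mul_nonpos_of_nonneg_of_nonpos (by simp) (by linarith)
      refine hsplit.trans ?_
      simp only [mul_sub, Finset.sum_sub_distrib]
      rw [hsum i hi']
      have h2 := hq.chain i hi'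
      have h3 : J.vol fr (i + 1) / u = J.m * J.d i - J.load fr v (i + 1) := by
        rw [div_eq_iff hu.ne', hw]; ring
      linarith
  refine ⟨⟨hu, ?_, ?_, ?_, ?_, hexcess, ?_⟩, ?_⟩
  · intro j hj hj'
    by_cases hf : fr j = 0
    · exact (hnew j hf hj').ge
    · rw [(hold j hf).2]; exact huL.trans (h.level j hj hf)
  · intro j hj
    rw [hdur]
    by_cases hf : fr j = 0
    · rw [JobData.dur, if_pos hf, div_le_iff₀ hu, mul_comm]
      exact hs.job j hj hf
    · have := h.window j hj
      simpa only [JobData.dur, if_neg hf] using this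
  · intro k hk
    rw [← J.sum_dur, hsum k hk]
    have := hs.chain k hk
    have h2 : J.vol fr (k + 1) / u ≤ J.m * J.d k - J.load fr v (k + 1) := by
      rw [div_le_iff₀ hu, mul_comm]; exact this
    linarith
  · intro j hj hj' l hl hl'
    by_cases hf : fr j = 0
    · rw [hnew j hf hj']
      have hj2 : lo ≤ j ∧ j < i + 1 := by
        rw [hfr] at hj'
        split_ifs at hj' with hc
        · exact ⟨hc.1, hc.2.1⟩
        · exact absurd hf hj'
      rcases hatt with ⟨rfl, _, hw⟩ | ⟨rfl, _, _⟩
      · obtain rfl : j = lo := by omega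
        rw [hw]; field_simp
      -- After a tight load constraint no unfrozen job remains below a newly frozen one.
      · have : fr' l ≠ 0 := by
          rw [hfr, if_pos ⟨Nat.zero_le _, by omega, hunf l hl'⟩]
          exact one_ne_zero
        exact absurd hl' this
    · rw [(hold j hf).2]
      exact h.cap j hj hf l hl (hunf l hl')
  · intro q hq a ha
    have h1 := h.opt q hq a ha
    have h2 := h.excess_nonpos q hq
    -- Only the newly frozen jobs change the two sums, and all of them have the weight `u ^ a`.
    have h3 : J.excess fr' v' (fun j => v' j ^ a) q - J.excess fr v (fun j => v j ^ a) q
        = u ^ a * (J.excess fr' v' 1 q - J.excess fr v 1 q) := by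
      simp only [JobData.excess, ← Finset.sum_sub_distrib, Finset.mul_sum]
      refine Finset.sum_congr rfl fun j _ => ?_
      by_cases hf : fr j = 0
      · by_cases hf' : fr' j = 0
        · simp [hf, hf']
        · simp only [hf, hf', if_true, if_false, hnew j hf hf', Pi.one_apply]; ring
      · simp [hf, (hold j hf).1, (hold j hf).2]
    -- Since the old excess is nonpositive, its factor `L ^ a` may be replaced by the smaller `u ^
    -- a`.
    have h4 : u ^ a ≤ L ^ a := Real.rpow_le_rpow hu.le huL ha.le
    nlinarith [mul_le_mul_of_nonpos_right h4 h2]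
  · rcases hatt with ⟨rfl, hf, hw⟩ | ⟨rfl, hvol, hw⟩
    · exact ⟨lo, hi', hf, by rw [hfr, if_pos ⟨le_rfl, Nat.lt_succ_self _, hf⟩]; exact one_ne_zero⟩
    · by_contra hcon
      push Not at hcon
      refine hvol.ne' (Finset.sum_eq_zero fun j hj => if_neg fun hf => ?_)
      have hj := Finset.mem_range.1 hj
      have := hcon j (by omega) hf
      rw [hfr, if_pos ⟨Nat.zero_le _, hj, hf⟩] at this
      exact one_ne_zero this

/-- The speeds `v` are optimal: their durations satisfy the load conditions, and they minimise the
energy among all durations that do. -/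
structure JobData.Optimal (J : JobData) (v : ℕ → ℝ) : Prop where
  pos : ∀ j < J.n, 0 < v j
  durations : J.Durations fun j => J.w j / v j
  opt : ∀ q, J.Durations q → ∀ a : ℝ, 0 < a →
    ∑ j ∈ Finset.range J.n, (J.z j : ℝ) * v j ^ a * (q j - J.w j / v j) ≤ 0

/-- When every job is frozen the level drops out of the durations, and the weighted excess is at
most `L ^ a` times a nonpositive number. -/
theorem FreezeInv.optimal {J : JobData} {fr : ℕ → ℕ} {v : ℕ → ℝ} {L : ℝ}
    (h : FreezeInv J fr v L) (hall : ∀ j < J.n, fr j ≠ 0) : J.Optimal v := by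
  have hdur : ∀ j < J.n, J.dur fr v L j = J.w j / v j := fun j hj => by
    simp [JobData.dur, hall j hj]
  refine ⟨fun j hj => h.pos.trans_le (h.level j hj (hall j hj)), ⟨fun j hj => ?_, fun k hk => ?_⟩,
    fun q hq a ha => ?_⟩
  · rw [← hdur j hj]; exact h.window j hj
  · have := h.chain k hk
    rw [← J.sum_dur] at this
    refine le_trans (le_of_eq (Finset.sum_congr rfl fun j hj => ?_)) this
    rw [hdur j (by have := Finset.mem_range.1 hj; omega)]
  · have h1 := h.opt q hq a ha
    have h2 := mul_nonpos_of_nonneg_of_nonpos (Real.rpow_nonneg h.pos.le a)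
      (h.excess_nonpos q hq)
    refine le_trans (le_of_eq (Finset.sum_congr rfl fun j hj => ?_)) (h1.trans h2)
    rw [if_neg (hall j (Finset.mem_range.1 hj))]

/-! ## The computation of the optimal speeds -/

/-- The data of the jobs in the order `o`. -/
noncomputable def RigidInstance.data (I : RigidInstance) (o : ℕ → ℕ) : JobData where
  n := I.n
  m := I.m
  z k := I.sz (o k)
  w k := I.wk (o k)
  d k := I.win (o k)

/-- The job at position `k`. -/
def jobExpr : NatExpr := .read 7 (nv 10)
/-- The size of the job at position `k`, as a real number. -/
def sizeExpr : RealExpr := .ofNat (.read 1 jobExpr)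
/-- The work of the job at position `k`. -/
def workExpr : RealExpr := .read 0 jobExpr
/-- The capacity of the window of the job at position `k` not used by frozen jobs. -/
def slackExpr : RealExpr :=
  .sub (.mul (.ofNat (.read 0 (.const 1))) (winExpr jobExpr)) (rv 9)

@[simp] theorem eval_jobExpr (I : RigidInstance) (M : Mem) :
    jobExpr.eval (enc I M) = M.ord M.k := rfl
@[simp] theorem eval_sizeExpr (I : RigidInstance) (M : Mem) :
    sizeExpr.eval (enc I M) = (I.data M.ord).z M.k := rfl
@[simp] theorem eval_workExpr (I : RigidInstance) (M : Mem) :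
    workExpr.eval (enc I M) = (I.data M.ord).w M.k := rfl
@[simp] theorem eval_winExpr_jobExpr (I : RigidInstance) (M : Mem) :
    (winExpr jobExpr).eval (enc I M) = (I.data M.ord).d M.k := rfl
@[simp] theorem eval_slackExpr (I : RigidInstance) (M : Mem) :
    slackExpr.eval (enc I M) = (I.data M.ord).m * (I.data M.ord).d M.k - M.A := rfl

/-- Adds the job at position `k` to the load or to the volume, and raises the level to its
density. -/
def scanJob : Program :=
  .cond (.natEq (.read 6 (nv 10)) (.const 0))
    (.seq (setR 10 (.add (rv 10) (.mul sizeExpr workExpr)))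
      (.cond (.realLt (.mul (rv 8) (winExpr jobExpr)) workExpr)
        (.seq (setR 8 (.div workExpr (winExpr jobExpr)))
          (.seq (setN 13 (nv 10)) (setN 14 (.add (nv 10) (.const 1))))) .skip))
    (setR 9 (.add (rv 9) (.mul sizeExpr (.div workExpr (.read 6 (nv 10))))))

/-- Raises the level until the jobs up to position `k` fit into their common window. -/
def scanChain : Program :=
  .cond (.realLt (.mul (rv 8) slackExpr) (rv 10))
    (.seq (setR 8 (.div (rv 10) slackExpr))
      (.seq (setN 13 (.const 0)) (setN 14 (.add (nv 10) (.const 1))))) .skip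

/-- One step of a scan. -/
def scanBody : Program := .seq scanJob (.seq scanChain (incr 10))

/-- Prepares a scan. -/
def scanInit : Program :=
  .seq (setR 8 (.ofNat (.const 0))) (.seq (setR 9 (.ofNat (.const 0)))
    (.seq (setR 10 (.ofNat (.const 0))) (.seq (setN 13 (.const 0))
      (.seq (setN 14 (.const 0)) (setN 10 (.const 0))))))

/-- Freezes the job at position `k` at the current level, unless it is frozen. -/
def applyBody : Program :=
  .seq (.cond (.natEq (.read 6 (nv 10)) (.const 0))
    (.seq (.assignNat 6 (nv 10) (.const 1)) (.assignReal 6 (nv 10) (rv 8))) .skip) (incr 10)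

/-- One round: finds the next level and the range of the jobs to be frozen, and freezes them. -/
def freezeBody : Program :=
  .seq scanInit (.seq (.loop (.natLt (nv 10) (nv 0)) scanBody)
    (.seq (setN 10 (nv 13)) (.loop (.natLt (nv 10) (nv 14)) applyBody)))

/-- Computes the optimal speeds. -/
def freezeProg : Program :=
  .seq (setN 14 (.const 1)) (.loop (.natLt (.const 0) (nv 14)) freezeBody)

/-! ### Correctness of the computation of the speeds. -/

theorem JobData.load_succ (J : JobData) (fr : ℕ → ℕ) (v : ℕ → ℝ) (k : ℕ) :
    J.load fr v (k + 1) = J.load fr v k + if fr k = 0 then 0 else (J.z k : ℝ) * (J.w k / v k) :=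
  Finset.sum_range_succ _ _

theorem JobData.vol_succ (J : JobData) (fr : ℕ → ℕ) (k : ℕ) :
    J.vol fr (k + 1) = J.vol fr k + if fr k = 0 then (J.z k : ℝ) * J.w k else 0 :=
  Finset.sum_range_succ _ _

/-- The hypothesis `hu` describes the outcome of `scanJob`: the level is unchanged, or it was raised
to the density of job `k`. The scan invariant still refers to the level `u` before that, so that one
step of `keep` or `raise` accounts for both tests. -/
theorem runs_scanChain {I : RigidInstance} (hJ : ∀ o, Sorted I o → (I.data o).Valid) {M : Mem}
    (ho : Sorted I M.ord) {L : ℝ} (hI : FreezeInv (I.data M.ord) M.fr M.v L)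
    (hk : M.k < I.n) (hA : M.A = (I.data M.ord).load M.fr M.v (M.k + 1))
    (hV : M.V = (I.data M.ord).vol M.fr (M.k + 1))
    {u : ℝ} {lo hi : ℕ} (h : ScanInv (I.data M.ord) M.fr M.v M.k u lo hi)
    (hu : (M.u = u ∧ M.lo = lo ∧ M.hi = hi ∧
        (M.fr M.k = 0 → 0 < u ∧ (I.data M.ord).w M.k ≤ u * (I.data M.ord).d M.k)) ∨
      (u < M.u ∧ M.lo = M.k ∧ M.hi = M.k + 1 ∧ M.fr M.k = 0 ∧
        (I.data M.ord).w M.k = M.u * (I.data M.ord).d M.k)) :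
    Runs I (.seq scanChain (incr 10)) M 100 fun M' => ∃ u' lo' hi',
      M' = { M with k := M.k + 1, u := u', lo := lo', hi := hi' } ∧
      ScanInv (I.data M.ord) M.fr M.v (M.k + 1) u' lo' hi' := by
  have hJ := hJ _ ho
  have hkJ : M.k < (I.data M.ord).n := hk
  have hd := hJ.d_pos _ hkJ
  have hule : u ≤ M.u := by rcases hu with h | h; exacts [h.1.ge, h.1.le]
  have hjob : M.fr M.k = 0 → (I.data M.ord).w M.k ≤ M.u * (I.data M.ord).d M.k := by
    intro hf
    rcases hu with h | h
    · rw [h.1]; exact (h.2.2.2 hf).2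
    · exact h.2.2.2.2.le
  refine Runs.of_wp ?_ (by decide)
  simp only [scanChain, Program.wp, wp_incr, wp_setN, wp_setR, holds_realLt, eval_rmul, eval_u,
    eval_slackExpr, eval_V, eval_k, eval_rdiv, eval_nconst, eval_nadd,
    write_u, write_lo, write_hi, write_k, post_enc]
  refine ⟨fun hlt => ⟨_, _, _, rfl, ?_⟩, fun hge => ?_⟩
  · rw [hA, hV] at *
    have hc := hI.chain _ hkJ
    have hload := hI.load_le hJ hkJ
    set X := (I.data M.ord).m * (I.data M.ord).d M.k
      - (I.data M.ord).load M.fr M.v (M.k + 1) with hX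
    have hV0 : 0 < (I.data M.ord).vol M.fr (M.k + 1) :=
      (mul_nonneg (h.nonneg.trans hule) (by linarith : 0 ≤ X)).trans_lt hlt
    -- The division is legitimate: at the old level the slack is at least the volume divided by `L`,
    -- and the volume is positive here.
    have hX0 : 0 < X := by
      have := div_pos hV0 hI.pos
      linarith
    have hraise : M.u < (I.data M.ord).vol M.fr (M.k + 1) / X := by rwa [lt_div_iff₀ hX0]
    have heq : (I.data M.ord).vol M.fr (M.k + 1)
        = (I.data M.ord).vol M.fr (M.k + 1) / X * X := by field_simp
    exact h.raise hJ hI hkJ (hule.trans_lt hraise)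
      (fun hf => (hjob hf).trans (mul_le_mul_of_nonneg_right hraise.le hd.le)) heq.le
      (Or.inr ⟨rfl, hV0, heq⟩)
  · refine ⟨M.u, M.lo, M.hi, rfl, ?_⟩
    rw [hA, hV] at hge
    rcases hu with ⟨h1, h2, h3, h4⟩ | ⟨h1, h2, h3, h4, h5⟩
    · rw [h1] at hge
      rw [h1, h2, h3]
      exact h.keep h4 (not_lt.1 hge)
    · rw [h2, h3]
      exact h.raise hJ hI hkJ h1 hjob (not_lt.1 hge) (Or.inl ⟨rfl, h4, h5⟩)

theorem runs_scanBody {I : RigidInstance} (hJ : ∀ o, Sorted I o → (I.data o).Valid) {M : Mem}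
    (ho : Sorted I M.ord) {L : ℝ} (hI : FreezeInv (I.data M.ord) M.fr M.v L)
    (hk : M.k < I.n) (hA : M.A = (I.data M.ord).load M.fr M.v M.k)
    (hV : M.V = (I.data M.ord).vol M.fr M.k)
    (h : ScanInv (I.data M.ord) M.fr M.v M.k M.u M.lo M.hi) :
    Runs I scanBody M 200 fun M' => ∃ u' lo' hi',
      M' = { M with
        k := M.k + 1, u := u', lo := lo', hi := hi'
        A := (I.data M.ord).load M.fr M.v (M.k + 1)
        V := (I.data M.ord).vol M.fr (M.k + 1) } ∧
      ScanInv (I.data M.ord) M.fr M.v (M.k + 1) u' lo' hi' := by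
  have hkJ : M.k < (I.data M.ord).n := hk
  have hd := (hJ _ ho).d_pos _ hkJ
  have hw := (hJ _ ho).w_pos _ hkJ
  refine Runs.mono (T := 100 + 100) (Runs.seq (Q := fun M1 => ∃ u lo hi,
      M1 = { M with
        u := u, lo := lo, hi := hi
        A := (I.data M.ord).load M.fr M.v (M.k + 1)
        V := (I.data M.ord).vol M.fr (M.k + 1) } ∧
      ((u = M.u ∧ lo = M.lo ∧ hi = M.hi ∧
        (M.fr M.k = 0 → 0 < M.u ∧ (I.data M.ord).w M.k ≤ M.u * (I.data M.ord).d M.k)) ∨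
      (M.u < u ∧ lo = M.k ∧ hi = M.k + 1 ∧ M.fr M.k = 0 ∧
        (I.data M.ord).w M.k = u * (I.data M.ord).d M.k)))
    (Runs.of_wp ?_ (by decide)) ?_) le_rfl (fun _ h => h)
  · simp only [scanJob, Program.wp, wp_setN, wp_setR, holds_realLt, holds_natEq, eval_rmul, eval_u,
      eval_V, eval_A, eval_v, eval_k, eval_rdiv, eval_radd, eval_nconst, eval_nadd, eval_sizeExpr,
      eval_workExpr, eval_winExpr_jobExpr, eval_fr,
      write_u, write_lo, write_hi, write_A, write_V, post_enc, JobData.load_succ,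
      JobData.vol_succ, hA, hV]
    refine ⟨fun hf => ⟨fun hlt => ⟨(I.data M.ord).w M.k / (I.data M.ord).d M.k, _, _, ?_,
        Or.inr ⟨?_, rfl, rfl, hf, ?_⟩⟩,
      fun hge => ⟨M.u, _, _, ?_, Or.inl ⟨rfl, rfl, rfl, fun _ => ⟨?_, not_lt.1 hge⟩⟩⟩⟩,
      fun hf => ⟨M.u, _, _, ?_, Or.inl ⟨rfl, rfl, rfl, fun h0 => absurd h0 hf⟩⟩⟩
    · simp [hf]
    · rwa [lt_div_iff₀ hd]
    · field_simp
    · simp [hf]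
    · have := hw.trans_le (not_lt.1 hge)
      exact pos_of_mul_pos_left this hd.le
    · simp [hf]
  · rintro M1 ⟨u, lo, hi, rfl, hu⟩
    exact runs_scanChain hJ (M := { M with
        u := u, lo := lo, hi := hi
        A := (I.data M.ord).load M.fr M.v (M.k + 1)
        V := (I.data M.ord).vol M.fr (M.k + 1) }) ho hI hk rfl rfl h hu

theorem runs_scanLoop {I : RigidInstance} (hJ : ∀ o, Sorted I o → (I.data o).Valid) {M : Mem}
    (ho : Sorted I M.ord) {L : ℝ} (hI : FreezeInv (I.data M.ord) M.fr M.v L)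
    (hk : M.k = 0) (hA : M.A = 0) (hV : M.V = 0) (hu : M.u = 0) (hlo : M.lo = 0)
    (hhi : M.hi = 0) :
    Runs I (.loop (.natLt (nv 10) (nv 0)) scanBody) M (I.n * 205 + 5) fun M' =>
      ScanInv (I.data M.ord) M.fr M.v I.n M'.u M'.lo M'.hi ∧ M'.ord = M.ord ∧ M'.fr = M.fr ∧
      M'.v = M.v := by
  refine Runs.mono (Runs.loop (T := 200)
    (fun N M' => M'.k ≤ I.n ∧ N = I.n - M'.k ∧ M'.ord = M.ord ∧ M'.fr = M.fr ∧ M'.v = M.v ∧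
      M'.A = (I.data M.ord).load M.fr M.v M'.k ∧ M'.V = (I.data M.ord).vol M.fr M'.k ∧
      ScanInv (I.data M.ord) M.fr M.v M'.k M'.u M'.lo M'.hi)
    ?_ I.n M ⟨by omega, by omega, rfl, rfl, rfl, ?_, ?_, ?_⟩) le_rfl ?_
  · rintro N M' ⟨hk, rfl, h1, h2, h3, h4, h5, h6⟩ hb
    simp only [holds_natLt, eval_k, eval_n] at hb
    rw [← h1, ← h2, ← h3] at hI h4 h6
    rw [← h1, ← h2] at h5
    refine Runs.mono (runs_scanBody hJ (h1 ▸ ho) hI hb h4 h5 h6) le_rfl ?_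
    rintro M'' ⟨u', lo', hi', rfl, h7⟩
    rw [h1, h2, h3] at h7
    exact ⟨I.n - (M'.k + 1), by omega, hb, rfl, h1, h2, h3, by simp [h1, h2, h3],
      by simp [h1, h2], h7⟩
  · rw [hA, hk]; simp [JobData.load]
  · rw [hV, hk]; simp [JobData.vol]
  · rw [hk, hu, hlo, hhi]; exact ScanInv.zero _ _ _
  · rintro M' ⟨⟨N, hk, _, h1, h2, h3, _, _, h6⟩, hb⟩
    simp only [holds_natLt, eval_k, eval_n] at hb
    obtain hkn : M'.k = I.n := by omega
    rw [hkn] at h6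
    exact ⟨h6, h1, h2, h3⟩

theorem runs_applyLoop {I : RigidInstance} {M : Mem} (hk : M.k = M.lo) (hlo : M.lo ≤ M.hi)
    (hhi : M.hi ≤ I.n) :
    Runs I (.loop (.natLt (nv 10) (nv 14)) applyBody) M (I.n * 55 + 5) fun M' =>
      M'.ord = M.ord ∧ M'.hi = M.hi ∧
      (∀ j, M'.fr j = if M.lo ≤ j ∧ j < M.hi ∧ M.fr j = 0 then 1 else M.fr j) ∧
      ∀ j, M'.v j = if M.lo ≤ j ∧ j < M.hi ∧ M.fr j = 0 then M.u else M.v j := by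
  refine Runs.mono (Runs.loop (T := 50)
    (fun N M' => M.lo ≤ M'.k ∧ M'.k ≤ M.hi ∧ N = M.hi - M'.k ∧ M'.ord = M.ord ∧ M'.hi = M.hi ∧
      M'.u = M.u ∧
      (∀ j, M'.fr j = if M.lo ≤ j ∧ j < M'.k ∧ M.fr j = 0 then 1 else M.fr j) ∧
      ∀ j, M'.v j = if M.lo ≤ j ∧ j < M'.k ∧ M.fr j = 0 then M.u else M.v j)
    ?_ (M.hi - M.lo) M ⟨hk.ge, by omega, by omega, rfl, rfl, rfl, ?_, ?_⟩)
    ?_ ?_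
  · rintro N M' ⟨hk1, hk2, rfl, h1, h2, h3, h4, h5⟩ hb
    simp only [holds_natLt, eval_k, eval_hi] at hb
    have h4k : M'.fr M'.k = M.fr M'.k := by rw [h4, if_neg (by omega)]
    refine Runs.of_wp ?_ (by decide)
    simp only [applyBody, Program.wp, wp_incr, holds_natEq, eval_fr, eval_k, eval_nconst, eval_u,
      write_fr, write_v, write_k, post_enc]
    refine ⟨fun hf => ?_, fun hf => ?_⟩
    · refine ⟨M.hi - (M'.k + 1), by omega, by omega, by omega, rfl, h1, h2, h3, fun j => ?_,
        fun j => ?_⟩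
      · by_cases hj : j = M'.k
        · subst hj
          rw [h4k] at hf
          simp [hk1, hf]
        · have : j < M'.k + 1 ↔ j < M'.k := by omega
          simp only [Function.update_apply, if_neg hj, h4, this]
      · by_cases hj : j = M'.k
        · subst hj
          rw [h4k] at hf
          simp [hk1, hf, h3]
        · have : j < M'.k + 1 ↔ j < M'.k := by omega
          simp only [Function.update_apply, if_neg hj, h5, this]
    · refine ⟨M.hi - (M'.k + 1), by omega, by omega, by omega, rfl, h1, h2, h3, fun j => ?_,
        fun j => ?_⟩
      · by_cases hj : j = M'.k
        · subst hj
          rw [h4k] at hf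
          simp [hf, h4k]
        · have : j < M'.k + 1 ↔ j < M'.k := by omega
          simp only [h4, this]
      · by_cases hj : j = M'.k
        · subst hj
          rw [h4k] at hf
          simp [hf, h5]
        · have : j < M'.k + 1 ↔ j < M'.k := by omega
          simp only [h5, this]
  · intro j; rw [if_neg (by omega)]
  · intro j; rw [if_neg (by omega)]
  · have : (Cond.natLt (nv 10) (nv 14)).cost = 5 := rfl
    rw [this]
    have : M.hi - M.lo ≤ I.n := by omega
    exact Nat.add_le_add_right (Nat.mul_le_mul_right 55 this) 5
  · rintro M' ⟨⟨N, hk1, hk2, _, h1, h2, h3, h4, h5⟩, hb⟩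
    simp only [holds_natLt, eval_k, eval_hi] at hb
    have : M'.k = M.hi := by omega
    rw [this] at h4 h5
    exact ⟨h1, h2, h4, h5⟩

/-- The number of unfrozen jobs. -/
def unfrozen (n : ℕ) (fr : ℕ → ℕ) : ℕ := ((Finset.range n).filter fun j => fr j = 0).card

/-- `hi = 0` after the scan means that no unfrozen job was met, so the speeds are final. Otherwise
at least one job is frozen, which bounds the number of rounds. -/
theorem runs_freezeBody {I : RigidInstance} (hJ : ∀ o, Sorted I o → (I.data o).Valid) {M : Mem}
    (ho : Sorted I M.ord) {L : ℝ} (hI : FreezeInv (I.data M.ord) M.fr M.v L) :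
    Runs I freezeBody M (I.n * 260 + 50) fun M' => M'.ord = M.ord ∧
      ((M'.hi = 0 ∧ (I.data M.ord).Optimal M'.v) ∨
        (0 < M'.hi ∧ unfrozen I.n M'.fr < unfrozen I.n M.fr ∧
          ∃ L', FreezeInv (I.data M.ord) M'.fr M'.v L')) := by
  refine Runs.mono (Runs.seq (T := 30) (T' := (I.n * 205 + 5) + (5 + (I.n * 55 + 5)))
    (Q := fun M' => M' = { M with u := 0, A := 0, V := 0, lo := 0, hi := 0, k := 0 })
    (Runs.of_wp (by simp [scanInit]) (by decide)) ?_) (by omega) (fun _ h => h)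
  rintro M1 rfl
  refine Runs.seq (runs_scanLoop hJ (M := { M with u := 0, A := 0, V := 0, lo := 0, hi := 0, k := 0 })
    ho hI rfl rfl rfl rfl rfl rfl) ?_
  rintro M2 ⟨hs, h1, h2, h3⟩
  dsimp only at hs h1 h2 h3
  refine Runs.seq (Q := fun M' => M' = { M2 with k := M2.lo }) (Runs.of_wp (by simp) (by decide)) ?_
  rintro M3 rfl
  have hlohi : M2.lo ≤ M2.hi ∧ M2.hi ≤ I.n := by
    rcases hs.attained with ⟨h4, h5, _⟩ | ⟨_, i, hi, h4, ⟨h5, _⟩ | ⟨h5, _⟩⟩ <;> omega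
  refine Runs.mono (runs_applyLoop (M := { M2 with k := M2.lo }) rfl hlohi.1 hlohi.2) le_rfl ?_
  rintro M4 ⟨h4, h5, h6, h7⟩
  dsimp only at h4 h5 h6 h7
  refine ⟨h4.trans h1, ?_⟩
  rw [h2] at h6 h7
  rw [h3] at h7
  rcases Nat.eq_zero_or_pos M2.hi with h0 | h0
  · refine Or.inl ⟨h5.trans h0, ?_⟩
    have hv : M4.v = M.v := by funext j; rw [h7, if_neg (by omega)]
    rw [hv]
    refine hI.optimal fun j hj => ?_
    rcases hs.attained with h | ⟨_, i, _, h, _⟩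
    · exact h.2.2.2 j hj
    · omega
  · obtain ⟨hf, j, hj, hj0, hj1⟩ := hI.freeze (hJ _ ho) hs h0 h6 h7
    refine Or.inr ⟨h5.symm ▸ h0, Finset.card_lt_card ((Finset.ssubset_iff_of_subset ?_).2 ⟨j, ?_, ?_⟩), _, hf⟩
    · intro l hl
      simp only [Finset.mem_filter] at hl ⊢
      refine ⟨hl.1, ?_⟩
      by_contra hne
      have := hl.2
      rw [h6, if_neg (fun h => hne h.2.2)] at this
      exact hne this
    · simpa [hj0] using (show j < I.n from hj)
    · simp [hj1]

theorem runs_freezeProg {I : RigidInstance} (hJ : ∀ o, Sorted I o → (I.data o).Valid) {M : Mem}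
    (ho : Sorted I M.ord) (hfr : M.fr = 0) :
    Runs I freezeProg M (4 + ((I.n + 1) * (5 + (I.n * 260 + 50)) + 5)) fun M' =>
      M'.ord = M.ord ∧ (I.data M.ord).Optimal M'.v := by
  refine Runs.mono (Runs.seq (T := 4) (Q := fun M' => M' = { M with hi := 1 })
    (Runs.of_wp (by simp) (by decide)) (T' := (I.n + 1) * (5 + (I.n * 260 + 50)) + 5) ?_)
    le_rfl (fun _ h => h)
  rintro M' rfl
  -- At most `n` rounds freeze a job, and one last round finds none; `hi = 1` only serves to enter
  -- the loop.
  refine Runs.mono (Runs.loop (T := I.n * 260 + 50)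
    (fun N M' => M'.ord = M.ord ∧ ((M'.hi = 0 ∧ (I.data M.ord).Optimal M'.v) ∨
      (0 < M'.hi ∧ unfrozen I.n M'.fr < N ∧ ∃ L', FreezeInv (I.data M.ord) M'.fr M'.v L')))
    ?_ (I.n + 1) _ ⟨rfl, Or.inr ⟨Nat.one_pos, ?_, ?_⟩⟩) ?_ ?_
  · rintro N M' ⟨h1, h | ⟨_, h2, L, h3⟩⟩ hb
    · simp [h.1] at hb
    · rw [← h1] at h3 ho
      refine Runs.mono (runs_freezeBody hJ ho h3) le_rfl ?_
      rintro M'' ⟨h4, h | ⟨h0, h5, h6⟩⟩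
      · exact ⟨0, by omega, h4.trans h1, Or.inl (h1 ▸ h)⟩
      · exact ⟨unfrozen I.n M'.fr, h2, h4.trans h1, Or.inr ⟨h0, h5, h1 ▸ h6⟩⟩
  · refine Nat.lt_succ_of_le ((Finset.card_filter_le _ _).trans (by simp))
  · dsimp only; rw [hfr]; exact exists_freezeInv (hJ _ ho) _
  · have : (Cond.natLt (.const 0) (nv 14)).cost ≤ 5 := by decide
    gcongr
  · rintro M' ⟨⟨N, h1, h2 | ⟨h0, _⟩⟩, hb⟩
    · exact ⟨h1, h2.2⟩
    · simp at hb; omega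

/-! ## List scheduling -/

/-- The segments `[slo b, shi b)`, `b < c`, partition `m` processors. -/
structure Segments (m c : ℕ) (slo shi : ℕ → ℕ) : Prop where
  le : ∀ b < c, slo b ≤ shi b
  le_m : ∀ b < c, shi b ≤ m
  sum : ∑ b ∈ Finset.range c, (shi b - slo b) = m
  disj : ∀ b < c, ∀ b' < c, ∀ q, slo b ≤ q → q < shi b → slo b' ≤ q → q < shi b' → b = b'

/-- The amount of work that is scheduled after time `t`, if the processors of segment `b` are
occupied until `f b`. -/
noncomputable def busy (c : ℕ) (slo shi : ℕ → ℕ) (f : ℕ → ℝ) (t : ℝ) : ℝ :=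
  ∑ b ∈ Finset.range c, ((shi b - slo b : ℕ) : ℝ) * max (f b - t) 0

/-- The number of processors in the segments `a ≤ b < c` that are free from time `t` on. -/
noncomputable def avail (a c : ℕ) (slo shi : ℕ → ℕ) (f : ℕ → ℝ) (t : ℝ) : ℕ :=
  ∑ b ∈ Finset.Ico a c, if f b ≤ t then shi b - slo b else 0

theorem avail_step {a c : ℕ} (h : a < c) (slo shi : ℕ → ℕ) (f : ℕ → ℝ) (t : ℝ) :
    avail a c slo shi f t = (if f a ≤ t then shi a - slo a else 0)
      + avail (a + 1) c slo shi f t := by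
  rw [avail, Finset.sum_eq_sum_Ico_succ_bot h]
  rfl

theorem avail_congr {a c : ℕ} {slo shi : ℕ → ℕ} {f f' : ℕ → ℝ} {t : ℝ}
    (h : ∀ b, a ≤ b → b < c → f' b = f b) :
    avail a c slo shi f' t = avail a c slo shi f t := by
  classical
  refine Finset.sum_congr rfl fun b hb => ?_
  have hb := Finset.mem_Ico.1 hb
  rw [h b hb.1 hb.2]

theorem avail_self (c : ℕ) (slo shi : ℕ → ℕ) (f : ℕ → ℝ) (t : ℝ) :
    avail c c slo shi f t = 0 := by
  simp [avail]

theorem busy_nonneg (c : ℕ) (slo shi : ℕ → ℕ) (f : ℕ → ℝ) (t : ℝ) :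
    0 ≤ busy c slo shi f t :=
  Finset.sum_nonneg fun _ _ => by positivity

/-! ### Splitting a segment of processors. -/

section Split

variable {c i r : ℕ} {slo shi : ℕ → ℕ}

/-- The two parts share the length of the old segment and inherit its time `f i`. Taking `g = 1`
preserves the number of processors, taking `g x = max (x - t) 0` preserves `busy`. -/
theorem sum_split (hi : i < c) (hr : r ≤ shi i - slo i) (f : ℕ → ℝ) (g : ℝ → ℝ) :
    ∑ b ∈ Finset.range (c + 1),
      ((Function.update (Function.update shi c (shi i)) i (slo i + r) b
        - Function.update slo c (slo i + r) b : ℕ) : ℝ) * g (Function.update f c (f i) b)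
      = ∑ b ∈ Finset.range c, ((shi b - slo b : ℕ) : ℝ) * g (f b) := by
  rw [Finset.sum_range_succ]
  have hmem : i ∈ Finset.range c := Finset.mem_range.2 hi
  rw [← Finset.add_sum_erase _ _ hmem, ← Finset.add_sum_erase _ _ hmem]
  have h1 : ∀ b ∈ (Finset.range c).erase i,
      ((Function.update (Function.update shi c (shi i)) i (slo i + r) b
        - Function.update slo c (slo i + r) b : ℕ) : ℝ) * g (Function.update f c (f i) b)
      = ((shi b - slo b : ℕ) : ℝ) * g (f b) := by
    intro b hb
    have hb := Finset.mem_erase.1 hb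
    have hbc : b ≠ c := (Finset.mem_range.1 hb.2).ne
    simp [hb.1, hbc]
  rw [Finset.sum_congr rfl h1]
  have hic : i ≠ c := hi.ne
  simp only [Function.update_apply, hic, hic.symm, if_true, if_false]
  have h2 : ((shi i - slo i : ℕ) : ℝ) = ((slo i + r - slo i : ℕ) : ℝ)
      + ((shi i - (slo i + r) : ℕ) : ℝ) := by
    rw [← Nat.cast_add]; congr 1; omega
  rw [h2]; ring

/-- Every new segment lies in an old one. Two new segments that meet lie in the same old one, and
the two parts of the split segment do not meet. -/
theorem Segments.split {m : ℕ} (h : Segments m c slo shi) (hi : i < c)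
    (hr : r ≤ shi i - slo i) :
    Segments m (c + 1) (Function.update slo c (slo i + r))
      (Function.update (Function.update shi c (shi i)) i (slo i + r)) := by
  have hic : i ≠ c := hi.ne
  have hle := h.le i hi
  have hm := h.le_m i hi
  have sub : ∀ b < c + 1, ∃ b0 < c, (b ≠ c → b = b0) ∧ (b = c → b0 = i) ∧
      slo b0 ≤ Function.update slo c (slo i + r) b ∧
      Function.update (Function.update shi c (shi i)) i (slo i + r) b ≤ shi b0 := by
    intro b hb
    by_cases hbc : b = c
    · refine ⟨i, hi, fun h => absurd hbc h, fun _ => rfl, ?_, ?_⟩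
      · simp [hbc]
      · simp [hbc, hic.symm]
    · refine ⟨b, by omega, fun _ => rfl, fun h => absurd h hbc, ?_, ?_⟩
      · simp [hbc]
      · by_cases hbi : b = i
        · subst hbi; simp; omega
        · simp [hbc, hbi]
  refine ⟨?_, ?_, ?_, ?_⟩
  · intro b hb
    by_cases hbc : b = c
    · simp [hbc, hic.symm]; omega
    · by_cases hbi : b = i
      · subst hbi; simp [hic]
      · simpa [Function.update_apply, hbc, hbi] using h.le b (by omega)
  · intro b hb
    obtain ⟨b0, h0, _, _, _, h1⟩ := sub b hb
    exact h1.trans (h.le_m b0 h0)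
  · have := sum_split (slo := slo) (shi := shi) hi hr (fun _ => 0) (fun _ => 1)
    simp only [mul_one] at this
    rw [← h.sum]
    exact_mod_cast this
  · intro b hb b' hb' q h1 h2 h3 h4
    obtain ⟨a, ha, ha1, ha2, ha3, ha4⟩ := sub b hb
    obtain ⟨a', ha', ha1', ha2', ha3', ha4'⟩ := sub b' hb'
    have haa := h.disj a ha a' ha' q (ha3.trans h1) (h2.trans_le ha4) (ha3'.trans h3)
      (h4.trans_le ha4')
    by_cases hbc : b = c <;> by_cases hbc' : b' = c
    · omega
    · have : b' = i := by rw [ha1' hbc', ← haa, ha2 hbc]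
      subst this
      simp [hbc] at h1
      simp at h4
      omega
    · have : b = i := by rw [ha1 hbc, haa, ha2' hbc']
      subst this
      simp [hbc'] at h3
      simp at h2
      omega
    · rw [ha1 hbc, haa, ← ha1' hbc']

end Split

/-- The state of list scheduling after the jobs `< K` have been placed: `off` are their start
times, `R i q` means that job `i` uses processor `q`, and `f b` is the time from which on the
processors of segment `b` are free. -/
structure Placement (J : JobData) (p : ℕ → ℝ) (K : ℕ) (t : ℝ) (c : ℕ) (slo shi : ℕ → ℕ)
    (f off : ℕ → ℝ) (R : ℕ → ℕ → Prop) : Prop where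
  seg : Segments J.m c slo shi
  fin : ∀ b < c, f b ≤ t ∨ ∃ i < K, f b = off i + p i
  future : ∀ i, K ≤ i → i < J.n → ∀ q, ¬ R i q
  lt_m : ∀ i < K, ∀ q, R i q → q < J.m
  free : ∀ i < K, ∀ q, R i q → ∀ b < c, slo b ≤ q → q < shi b → off i + p i ≤ f b
  disj : ∀ i i', i < i' → i' < K → ∀ q, R i q → R i' q → off i + p i ≤ off i'

open Classical in
/-- The placed job `i` has its processors and is not finished too late. -/
structure Placed (J : JobData) (p off : ℕ → ℝ) (R : ℕ → ℕ → Prop) (i : ℕ) : Prop where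
  nonneg : 0 ≤ off i
  card : ((Finset.range J.m).filter (R i)).card = J.z i
  finish : ((J.m : ℝ) + 1) * (off i + p i) ≤ (3 * J.m - 1) * J.d i

/-- The invariant of list scheduling. -/
structure ListInv (J : JobData) (p : ℕ → ℝ) (K : ℕ) (t : ℝ) (c : ℕ) (slo shi : ℕ → ℕ)
    (f off : ℕ → ℝ) (R : ℕ → ℕ → Prop) : Prop where
  le_n : K ≤ J.n
  placement : Placement J p K t c slo shi f off R
  c_le : c ≤ K + 1
  t_nonneg : 0 ≤ t
  placed : ∀ i < K, Placed J p off R i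
  load : ((J.m : ℝ) + 1) / 2 * t + busy c slo shi f t
    ≤ ∑ i ∈ Finset.range K, (J.z i : ℝ) * p i

/-- The number of jobs finished after time `t`. -/
noncomputable def pending (p : ℕ → ℝ) (K : ℕ) (off : ℕ → ℝ) (t : ℝ) : ℕ :=
  ((Finset.range K).filter fun i => t < off i + p i).card

/-- Between `t` and the next time `t'` at which a segment becomes free, the set of occupied
processors does not change. At least (m+1)/2 of them are occupied, so `busy` falls at least as fast
as (m+1)/2 · t grows. -/
theorem ListInv.advance {J : JobData} (hJ : J.Valid) {p : ℕ → ℝ} {K c : ℕ} {t t' : ℝ}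
    {slo shi : ℕ → ℕ} {f off : ℕ → ℝ} {R : ℕ → ℕ → Prop}
    (h : ListInv J p K t c slo shi f off R) (hK : K < J.n)
    (hfree : avail 0 c slo shi f t < J.z K) (htt : t < t') (hex : ∃ b < c, f b = t')
    (hmin : ∀ b < c, t < f b → t' ≤ f b) :
    ListInv J p K t' c slo shi f off R ∧ pending p K off t' < pending p K off t := by
  classical
  refine ⟨⟨h.le_n, ⟨h.placement.seg, fun b hb => ?_, h.placement.future, h.placement.lt_m,
    h.placement.free, h.placement.disj⟩, h.c_le, h.t_nonneg.trans htt.le, h.placed, ?_⟩, ?_⟩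
  · exact (h.placement.fin b hb).imp_left fun h => h.trans htt.le
  · refine le_trans ?_ h.load
    have h1 : (J.m : ℝ) = avail 0 c slo shi f t
        + ∑ b ∈ Finset.range c, if f b ≤ t then 0 else ((shi b - slo b : ℕ) : ℝ) := by
      conv_lhs => rw [← h.placement.seg.sum]
      rw [avail, Nat.cast_sum, Nat.cast_sum, Nat.Ico_zero_eq_range, ← Finset.sum_add_distrib]
      refine Finset.sum_congr rfl fun b _ => ?_
      split_ifs <;> simp
    have h2 : busy c slo shi f t' + (∑ b ∈ Finset.range c,
        if f b ≤ t then 0 else ((shi b - slo b : ℕ) : ℝ)) * (t' - t) ≤ busy c slo shi f t := by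
      rw [busy, busy, Finset.sum_mul, ← Finset.sum_add_distrib]
      refine Finset.sum_le_sum fun b hb => ?_
      have hb := Finset.mem_range.1 hb
      split_ifs with hf
      · rw [zero_mul, add_zero]
        exact mul_le_mul_of_nonneg_left (max_le_max (by linarith) le_rfl) (Nat.cast_nonneg _)
      · have := hmin b hb (not_le.1 hf)
        rw [max_eq_left (by linarith), max_eq_left (by linarith)]
        apply le_of_eq; ring
    -- At most size_K - 1 ≤ m/2 - 1 processors are free, so at least m/2 + 1 are occupied; (m+1)/2
    -- suffices.
    have h3 : (avail 0 c slo shi f t : ℝ) + 1 ≤ J.z K := by exact_mod_cast hfree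
    have h4 : (2 : ℝ) * J.z K ≤ J.m := by exact_mod_cast hJ.z_le K hK
    nlinarith
  · obtain ⟨b, hb, hft⟩ := hex
    -- A segment that becomes free at `t' > t` waits for a placed job finishing then; this job is
    -- pending at `t` but not at `t'`.
    obtain ⟨i, hi, hfi⟩ := (h.placement.fin b hb).resolve_left (by linarith)
    refine Finset.card_lt_card ((Finset.ssubset_iff_of_subset ?_).2 ⟨i, ?_, ?_⟩)
    · intro l hl
      simp only [Finset.mem_filter] at hl ⊢
      exact ⟨hl.1, htt.trans hl.2⟩
    · simp only [Finset.mem_filter, Finset.mem_range]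
      exact ⟨hi, by linarith⟩
    · simp only [Finset.mem_filter, Finset.mem_range, not_and, not_lt]
      intro _; linarith

/-- Guarantees that there is a time to advance to: otherwise all `m` processors would be free,
enough for job `K`. -/
theorem ListInv.exists_busy {J : JobData} (hJ : J.Valid) {p : ℕ → ℝ} {K c : ℕ} {t : ℝ}
    {slo shi : ℕ → ℕ} {f off : ℕ → ℝ} {R : ℕ → ℕ → Prop}
    (h : ListInv J p K t c slo shi f off R) (hK : K < J.n)
    (hfree : avail 0 c slo shi f t < J.z K) : ∃ b < c, t < f b := by
  classical
  by_contra hcon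
  push Not at hcon
  have : avail 0 c slo shi f t = J.m := by
    rw [← h.placement.seg.sum, avail, Nat.Ico_zero_eq_range]
    exact Finset.sum_congr rfl fun b hb => if_pos (hcon b (Finset.mem_range.1 hb))
  have := hJ.z_le K hK
  omega

open Classical in
/-- The invariant while processors are assigned to job `K`: the segments `< a` have been
inspected, and `r` processors are still needed. -/
structure AssignInv (J : JobData) (p : ℕ → ℝ) (K : ℕ) (t : ℝ) (a r c : ℕ) (slo shi : ℕ → ℕ)
    (f off : ℕ → ℝ) (R : ℕ → ℕ → Prop) : Prop where
  placement : Placement J p (K + 1) t c slo shi f off R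
  off_eq : off K = t
  le_c : a ≤ c
  c_le : c + (if 0 < r then 1 else 0) ≤ K + 2
  t_nonneg : 0 ≤ t
  placed : ∀ i < K, Placed J p off R i
  card : ((Finset.range J.m).filter (R K)).card + r = J.z K
  done : ∀ q, R K q → ∃ b < a, slo b ≤ q ∧ q < shi b
  enough : r ≤ avail a c slo shi f t
  load : ((J.m : ℝ) + 1) / 2 * t + busy c slo shi f t
    ≤ ∑ i ∈ Finset.range K, (J.z i : ℝ) * p i + ((J.z K : ℝ) - r) * p K
  busy_ge : ((J.z K : ℝ) - r) * p K ≤ busy c slo shi f t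

/-! ### Assigning processors to one job. -/

section Assign

variable {J : JobData} {p : ℕ → ℝ} {K a r c : ℕ} {t : ℝ} {slo shi : ℕ → ℕ}
  {f off : ℕ → ℝ} {R : ℕ → ℕ → Prop}

/-- Nothing is assigned yet, so all size_K processors are still needed. The bound on the number of
segments gains one unit, held in reserve for a split. -/
theorem ListInv.assign (h : ListInv J p K t c slo shi f off R) (hJ : J.Valid) (hK : K < J.n)
    (hfree : J.z K ≤ avail 0 c slo shi f t) :
    AssignInv J p K t 0 (J.z K) c slo shi f (Function.update off K t) R := by
  classical
  have hoff : ∀ i < K, Function.update off K t i = off i := fun i hi => by simp [hi.ne]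
  have hR := h.placement.future K le_rfl hK
  refine ⟨⟨h.placement.seg, fun b hb => ?_, fun i hi => h.placement.future i (by omega),
    fun i hi q hq => ?_, fun i hi q hq => ?_, fun i i' hi hi' q hq hq' => ?_⟩, by simp,
    Nat.zero_le _, ?_, h.t_nonneg, fun i hi => ?_, ?_, fun q hq => absurd hq (hR q), hfree, ?_, ?_⟩
  · refine (h.placement.fin b hb).imp_right ?_
    rintro ⟨i, hi, hf⟩
    exact ⟨i, by omega, by rw [hoff i hi, hf]⟩
  · rcases Nat.lt_succ_iff_lt_or_eq.1 hi with hi | rfl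
    · exact h.placement.lt_m i hi q hq
    · exact absurd hq (hR q)
  · rcases Nat.lt_succ_iff_lt_or_eq.1 hi with hi | rfl
    · rw [hoff i hi]; exact h.placement.free i hi q hq
    · exact absurd hq (hR q)
  · rcases Nat.lt_succ_iff_lt_or_eq.1 hi' with hi' | rfl
    · rw [hoff i (hi.trans hi'), hoff i' hi']; exact h.placement.disj i i' hi hi' q hq hq'
    · exact absurd hq' (hR q)
  · rw [if_pos (hJ.z_pos K hK)]
    have := h.c_le
    omega
  · obtain ⟨h1, h2, h3⟩ := h.placed i hi
    exact ⟨by rwa [hoff i hi], h2, by rwa [hoff i hi]⟩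
  · rw [Finset.filter_false_of_mem (fun q _ => hR q)]; simp
  · simpa using h.load
  · simpa using busy_nonneg c slo shi f t

/-- The approximation bound arises here. No segment is left to inspect, so `enough` forces `r = 0`.
Then `load` and `busy_ge` give (m+1)/2 · t + size_K p_K ≤ Σ_{i ≤ K} size_i p_i, which is at most m
d_K by the load condition. -/
theorem AssignInv.finish (h : AssignInv J p K t a r c slo shi f off R) (hJ : J.Valid)
    (hp : J.Durations p) (hK : K < J.n) (ha : c ≤ a) :
    ListInv J p (K + 1) t c slo shi f off R := by
  have hac : a = c := le_antisymm h.le_c ha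
  have hr : r = 0 := by
    have := h.enough
    rw [hac, avail_self] at this
    omega
  subst hr
  have hl := h.load
  have hb := h.busy_ge
  simp only [Nat.cast_zero, sub_zero] at hl hb
  have hl' : ((J.m : ℝ) + 1) / 2 * t + busy c slo shi f t
      ≤ ∑ i ∈ Finset.range (K + 1), (J.z i : ℝ) * p i := by
    rw [Finset.sum_range_succ]; exact hl
  refine ⟨hK, h.placement, by simpa using h.c_le, h.t_nonneg, fun i hi => ?_, hl'⟩
  rcases Nat.lt_succ_iff_lt_or_eq.1 hi with hi | rfl
  · exact h.placed i hi
  · refine ⟨h.off_eq ▸ h.t_nonneg, by simpa using h.card, ?_⟩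
    rw [h.off_eq]
    have h1 := hp.chain i hK
    have h2 := hp.le i hK
    have h3 : (2 : ℝ) * J.z i ≤ J.m := by exact_mod_cast hJ.z_le i hK
    have h4 : (1 : ℝ) ≤ J.z i := by exact_mod_cast hJ.z_pos i hK
    -- Small jobs make this coefficient positive, so p ≤ d yields (m+1)(t + p) ≤ (3m + 1 - 2 size)
    -- d; size ≥ 1 then gives 3m - 1.
    have h5 : ((J.m : ℝ) + 1 - 2 * J.z i) * p i ≤ ((J.m : ℝ) + 1 - 2 * J.z i) * J.d i :=
      mul_le_mul_of_nonneg_left h2 (by linarith)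
    have h6 : (J.d i : ℝ) ≤ J.z i * J.d i := le_mul_of_one_le_left (hJ.d_pos i hK).le h4
    nlinarith

theorem AssignInv.skip (h : AssignInv J p K t a r c slo shi f off R) (ha : a < c)
    (hs : t < f a ∨ r = 0) : AssignInv J p K t (a + 1) r c slo shi f off R := by
  classical
  refine { h with le_c := ha, done := fun q hq => ?_, enough := ?_ }
  · obtain ⟨b, hb, hq⟩ := h.done q hq
    exact ⟨b, by omega, hq⟩
  · have := h.enough
    rw [avail_step ha] at this
    rcases hs with hs | hs
    · simpa [hs.not_ge] using this
    · omega

theorem AssignInv.split (h : AssignInv J p K t a r c slo shi f off R) (ha : a < c)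
    (hf : f a ≤ t) (hr : r < shi a - slo a) :
    Placement J p (K + 1) t (c + 1) (Function.update slo c (slo a + r))
      (Function.update (Function.update shi c (shi a)) a (slo a + r))
      (Function.update f c (f a)) off R := by
  have hac : a ≠ c := ha.ne
  refine ⟨h.placement.seg.split ha hr.le, fun b hb => ?_, h.placement.future, h.placement.lt_m,
    fun i hi q hq b hb h1 h2 => ?_, h.placement.disj⟩
  · by_cases hbc : b = c
    · subst hbc; simp [hf]
    · simpa [hbc] using h.placement.fin b (by omega)
  · have hle := h.placement.seg.le a ha
    by_cases hbc : b = c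
    · subst hbc
      simp [hac.symm] at h1 h2 ⊢
      exact h.placement.free i hi q hq a ha (by omega) h2
    · simp only [Function.update_apply, hbc, if_false] at h1 h2 ⊢
      refine h.placement.free i hi q hq b (by omega) h1 ?_
      split_ifs at h2 with hba
      · subst hba; omega
      · exact h2

/-- The segments after the step are separate variables, so that the lemma covers both a whole
segment and the front part of one just split. -/
theorem AssignInv.take (h : AssignInv J p K t a r c slo shi f off R) (hK : K < J.n)
    (hp : 0 < p K) {c' : ℕ} {slo' shi' : ℕ → ℕ} {f' f'' : ℕ → ℝ} {R' : ℕ → ℕ → Prop}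
    (hpl : Placement J p (K + 1) t c' slo' shi' f' off R) (ha : a < c')
    (hsub : ∀ b < a, slo b = slo' b ∧ shi b = shi' b)
    (hbusy : busy c' slo' shi' f' t = busy c slo shi f t)
    (hf : f' a ≤ t) (hr : shi' a - slo' a ≤ r)
    (hc : c' + (if 0 < r - (shi' a - slo' a) then 1 else 0) ≤ K + 2)
    (hen : r ≤ avail a c' slo' shi' f' t)
    (hf'' : f'' = Function.update f' a (t + p K))
    (hR : ∀ i < J.n, ∀ q, R' i q ↔ R i q ∨ (i = K ∧ slo' a ≤ q ∧ q < shi' a)) :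
    AssignInv J p K t (a + 1) (r - (shi' a - slo' a)) c' slo' shi' f'' off R' := by
  classical
  subst hf''
  have hRlt : ∀ i < K, ∀ q, R' i q ↔ R i q := fun i hi q => by
    rw [hR i (by omega)]; simp [hi.ne]
  have hRK : ∀ q, R' K q ↔ R K q ∨ (slo' a ≤ q ∧ q < shi' a) := fun q => by
    rw [hR K hK]; simp
  -- Segment `a` was free by `t` and contributed nothing; now it is occupied for `p K` time units
  -- after `t`.
  have hbusy' : busy c' slo' shi' (Function.update f' a (t + p K)) t
      = busy c slo shi f t + ((shi' a - slo' a : ℕ) : ℝ) * p K := by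
    rw [← hbusy, busy, busy]
    have hmem : a ∈ Finset.range c' := Finset.mem_range.2 ha
    rw [← Finset.add_sum_erase _ _ hmem, ← Finset.add_sum_erase _ _ hmem]
    have h1 : ∀ b ∈ (Finset.range c').erase a,
        ((shi' b - slo' b : ℕ) : ℝ) * max (Function.update f' a (t + p K) b - t) 0
          = ((shi' b - slo' b : ℕ) : ℝ) * max (f' b - t) 0 := by
      intro b hb
      rw [Function.update_of_ne (Finset.ne_of_mem_erase hb)]
    rw [Finset.sum_congr rfl h1, Function.update_self, max_eq_right (by linarith : f' a - t ≤ 0),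
      max_eq_left (by linarith)]
    ring
  have hrest : (((r - (shi' a - slo' a) : ℕ)) : ℝ) = (r : ℝ) - ((shi' a - slo' a : ℕ) : ℝ) :=
    Nat.cast_sub hr
  refine ⟨⟨hpl.seg, fun b hb => ?_, fun i hi hi' q hq => ?_, fun i hi q hq => ?_,
    fun i hi q hq b hb h1 h2 => ?_, fun i i' hi hi' q hq hq' => ?_⟩, h.off_eq, ha, hc, h.t_nonneg,
    fun i hi => ?_, ?_, fun q hq => ?_, ?_, ?_, ?_⟩
  · by_cases hba : b = a
    · subst hba
      exact Or.inr ⟨K, Nat.lt_succ_self _, by simp [h.off_eq]⟩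
    · simpa [hba] using hpl.fin b hb
  · rcases (hR i hi' q).1 hq with hq | hq
    · exact hpl.future i hi hi' q hq
    · omega
  · rcases (hR i (by omega) q).1 hq with hq | hq
    · exact hpl.lt_m i hi q hq
    · exact hq.2.2.trans_le (hpl.seg.le_m a ha)
  · by_cases hba : b = a
    · subst hba
      rw [Function.update_self]
      rcases Nat.lt_succ_iff_lt_or_eq.1 hi with hi' | rfl
      · have := hpl.free i hi q ((hRlt i hi' q).1 hq) b hb h1 h2
        linarith
      · rw [h.off_eq]
    · rw [Function.update_of_ne hba]
      rcases (hR i (by omega) q).1 hq with hq | ⟨_, h3, h4⟩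
      · exact hpl.free i hi q hq b hb h1 h2
      · exact absurd (hpl.seg.disj b hb a ha q h1 h2 h3 h4) hba
  · have hq := (hRlt i (by omega) q).1 hq
    rcases (hR i' (by omega) q).1 hq' with hq' | ⟨rfl, h3, h4⟩
    · exact hpl.disj i i' hi hi' q hq hq'
    · rw [h.off_eq]
      exact (hpl.free i (by omega) q hq a ha h3 h4).trans hf
  · obtain ⟨h1, h2, h3⟩ := h.placed i hi
    refine ⟨h1, ?_, h3⟩
    rw [← h2]
    exact congrArg _ (Finset.filter_congr fun q _ => hRlt i hi q)
  · have hunion : (Finset.range J.m).filter (R' K)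
        = (Finset.range J.m).filter (R K) ∪ Finset.Ico (slo' a) (shi' a) := by
      ext q
      simp only [Finset.mem_filter, Finset.mem_range, Finset.mem_union, Finset.mem_Ico, hRK]
      constructor
      · tauto
      · rintro (h1 | h1)
        · tauto
        · exact ⟨h1.2.trans_le (hpl.seg.le_m a ha), Or.inr h1⟩
    rw [hunion, Finset.card_union_of_disjoint, Nat.card_Ico]
    · have := h.card
      omega
    -- The processors taken earlier lie in segments below `a`, hence not in segment `a`.
    · rw [Finset.disjoint_left]
      intro q hq hq'
      simp only [Finset.mem_filter, Finset.mem_Ico] at hq hq'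
      obtain ⟨b, hb, h1, h2⟩ := h.done q hq.2
      rw [(hsub b hb).1] at h1
      rw [(hsub b hb).2] at h2
      exact hb.ne (hpl.seg.disj b (hb.trans ha) a ha q h1 h2 hq'.1 hq'.2)
  · rcases (hRK q).1 hq with hq | hq
    · obtain ⟨b, hb, h1, h2⟩ := h.done q hq
      exact ⟨b, by omega, (hsub b hb).1 ▸ h1, (hsub b hb).2 ▸ h2⟩
    · exact ⟨a, Nat.lt_succ_self _, hq⟩
  · rw [avail_congr (f := f') fun b hb _ => Function.update_of_ne (by omega) _ _]
    rw [avail_step ha, if_pos hf] at hen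
    omega
  · rw [hbusy', hrest]
    have := h.load
    linarith
  · rw [hbusy', hrest]
    have := h.busy_ge
    linarith

/-- A placement may create one pending job. The factor 2 in `Mem.listLeft` pays for it and still
leaves a decrease. -/
theorem pending_succ_le (p : ℕ → ℝ) (K : ℕ) (off : ℕ → ℝ) (t x : ℝ) :
    pending p (K + 1) (Function.update off K x) t ≤ pending p K off t + 1 := by
  classical
  rw [pending, pending, Finset.range_add_one, Finset.filter_insert]
  have : ((Finset.range K).filter fun i => t < Function.update off K x i + p i)
      = (Finset.range K).filter fun i => t < off i + p i := by
    refine Finset.filter_congr fun i hi => ?_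
    rw [Function.update_of_ne (Finset.mem_range.1 hi).ne]
  rw [this]
  split_ifs
  · exact Finset.card_insert_le _ _
  · omega

end Assign

/-! ## The list scheduling program -/

/-- The duration of the job at position `k` at its optimal speed. -/
def durExpr : RealExpr := .div workExpr (.read 6 (nv 10))

@[simp] theorem eval_durExpr (I : RigidInstance) (M : Mem) :
    durExpr.eval (enc I M) = (I.data M.ord).w M.k / M.v M.k := rfl

/-- The length of segment `i`. -/
def lenExpr : NatExpr := .sub (.read 9 (nv 11)) (.read 8 (nv 11))

@[simp] theorem eval_lenExpr (I : RigidInstance) (M : Mem) :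
    lenExpr.eval (enc I M) = M.shi M.i - M.slo M.i := rfl

/-- Adds the length of segment `i` to the number of free processors, if it is free. -/
def countBody : Program :=
  .seq (.cond (.realLe (.read 7 (nv 11)) (rv 11)) (setN 12 (.add (nv 12) lenExpr)) .skip) (incr 11)

/-- Updates the first time after `t` at which a segment becomes free. -/
def nextBody : Program :=
  .seq (.cond (.realLe (.read 7 (nv 11)) (rv 11)) .skip
    (.cond (.realLe (rv 8) (rv 11)) (setR 8 (.read 7 (nv 11)))
      (.cond (.realLt (.read 7 (nv 11)) (rv 8)) (setR 8 (.read 7 (nv 11))) .skip))) (incr 11)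

/-- Splits segment `i` if it is longer than needed. -/
def splitProg : Program :=
  .cond (.natLt (nv 16) lenExpr)
    (.seq (.assignNat 8 (nv 15) (.add (.read 8 (nv 11)) (nv 16)))
      (.seq (.assignNat 9 (nv 15) (.read 9 (nv 11)))
        (.seq (.assignReal 7 (nv 15) (.read 7 (nv 11)))
          (.seq (.assignNat 9 (nv 11) (.add (.read 8 (nv 11)) (nv 16))) (incr 15))))) .skip

/-- Assigns segment `i` to the job at position `k`. -/
def takeProg : Program :=
  .seq (.assignNat 3 (nv 2) jobExpr)
    (.seq (.assignNat 4 (nv 2) (.read 8 (nv 11)))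
      (.seq (.assignNat 5 (nv 2) (.read 9 (nv 11)))
        (.seq (.assignReal 7 (nv 11) (.add (rv 11) durExpr))
          (.seq (setN 16 (.sub (nv 16) lenExpr)) (incr 2)))))

/-- Inspects segment `i` for the assignment to the job at position `k`. -/
def assignBody : Program :=
  .seq (.cond (.realLe (.read 7 (nv 11)) (rv 11))
    (.cond (.natLt (.const 0) (nv 16)) (.seq splitProg takeProg) .skip) .skip) (incr 11)

/-- Advances the time. -/
def advanceProg : Program :=
  .seq (.seq (setR 8 (rv 11)) (setN 11 (.const 0)))
    (.seq (.loop (.natLt (nv 11) (nv 15)) nextBody) (setR 11 (rv 8)))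

/-- Places the job at position `k`. -/
def placeProg : Program :=
  .seq (.seq (setN 16 (.read 1 jobExpr))
      (.seq (setN 11 (.const 0)) (.assignReal 5 (nv 10) (rv 11))))
    (.seq (.loop (.natLt (nv 11) (nv 15)) assignBody) (incr 10))

/-- Places the next job if enough processors are free, and advances the time otherwise. -/
def listBody : Program :=
  .seq (.seq (setN 12 (.const 0)) (setN 11 (.const 0)))
    (.seq (.loop (.natLt (nv 11) (nv 15)) countBody)
      (.cond (.natLt (nv 12) (.read 1 jobExpr)) advanceProg placeProg))

/-- List scheduling with the optimal speeds. -/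
def listProg : Program :=
  .seq (.seq (setN 2 (.const 0)) (.seq (.assignNat 8 (.const 0) (.const 0))
    (.seq (.assignNat 9 (.const 0) (.read 0 (.const 1)))
      (.seq (.assignReal 7 (.const 0) (.ofNat (.const 0))) (.seq (setN 15 (.const 1))
        (.seq (setR 11 (.ofNat (.const 0))) (setN 10 (.const 0))))))))
    (.loop (.natLt (nv 10) (nv 0)) listBody)

/-- The processors of the job at position `i`. -/
def Mem.Uses (M : Mem) (i q : ℕ) : Prop :=
  ∃ b < M.B, M.rj b = M.ord i ∧ M.rlo b ≤ q ∧ q < M.rhi b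

/-- The duration of the job at position `i`. -/
noncomputable def Mem.dur (I : RigidInstance) (M : Mem) (i : ℕ) : ℝ :=
  (I.data M.ord).w i / M.v i

/-! ### Correctness of the list scheduling program. -/

theorem runs_countLoop (I : RigidInstance) (M : Mem) (hi : M.i = 0) (hr : M.r = 0) :
    Runs I (.loop (.natLt (nv 11) (nv 15)) countBody) M (M.c * 45 + 5) fun M' =>
      M' = { M with i := M.c, r := avail 0 M.c M.slo M.shi M.f M.t } := by
  refine Runs.mono (Runs.loop (T := 40)
    (fun N M' => ∃ i ≤ M.c, N = M.c - i ∧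
      M' = { M with i := i, r := avail 0 i M.slo M.shi M.f M.t })
    ?_ M.c M ⟨0, Nat.zero_le _, rfl, ?_⟩) le_rfl ?_
  · rintro N M' ⟨i, hi, rfl, rfl⟩ hb
    simp only [holds_natLt, eval_i, eval_c] at hb
    have hs : avail 0 (i + 1) M.slo M.shi M.f M.t = avail 0 i M.slo M.shi M.f M.t
        + if M.f i ≤ M.t then M.shi i - M.slo i else 0 := by
      rw [avail, avail, Nat.Ico_zero_eq_range, Nat.Ico_zero_eq_range, Finset.sum_range_succ]
    refine Runs.of_wp ?_ (by decide)
    simp only [countBody, Program.wp, wp_incr, wp_setN, holds_realLe, eval_f, eval_i, eval_t,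
      eval_r, eval_nadd, eval_lenExpr, write_r, write_i, post_enc]
    refine ⟨fun hf => ⟨M.c - (i + 1), by omega, i + 1, hb, rfl, ?_⟩,
      fun hf => ⟨M.c - (i + 1), by omega, i + 1, hb, rfl, ?_⟩⟩
    · rw [hs, if_pos hf]
    · rw [hs, if_neg hf, add_zero]
  · cases M; simp_all [avail]
  · rintro M' ⟨⟨N, i, hi, rfl, rfl⟩, hb⟩
    simp only [holds_natLt, eval_i, eval_c] at hb
    obtain rfl : i = M.c := by omega
    rfl

/-- The value `u = t` encodes that no time later than `t` has been found yet; any other `u` is the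
least one found. -/
theorem runs_nextLoop (I : RigidInstance) (M : Mem) (hi : M.i = 0) (hu : M.u = M.t) :
    Runs I (.loop (.natLt (nv 11) (nv 15)) nextBody) M (M.c * 55 + 5) fun M' =>
      ∃ u, M' = { M with i := M.c, u := u } ∧
      ((u = M.t ∧ ∀ b < M.c, M.f b ≤ M.t) ∨
        (M.t < u ∧ (∃ b < M.c, M.f b = u) ∧ ∀ b < M.c, M.t < M.f b → u ≤ M.f b)) := by
  refine Runs.mono (Runs.loop (T := 50)
    (fun N M' => ∃ i ≤ M.c, N = M.c - i ∧ ∃ u, M' = { M with i := i, u := u } ∧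
      ((u = M.t ∧ ∀ b < i, M.f b ≤ M.t) ∨
        (M.t < u ∧ (∃ b < i, M.f b = u) ∧ ∀ b < i, M.t < M.f b → u ≤ M.f b)))
    ?_ M.c M ⟨0, Nat.zero_le _, rfl, M.t, ?_, by simp⟩) le_rfl ?_
  · rintro N M' ⟨i, hi, rfl, u, rfl, hinv⟩ hb
    simp only [holds_natLt, eval_i, eval_c] at hb
    refine Runs.of_wp ?_ (by decide)
    simp only [nextBody, Program.wp, wp_incr, wp_setR, holds_realLe, holds_realLt, eval_f, eval_i,
      eval_t, eval_u, write_u, write_i, post_enc, not_le, not_lt]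
    refine ⟨fun hf => ⟨M.c - (i + 1), by omega, i + 1, hb, rfl, u, rfl, ?_⟩,
      fun hf => ⟨fun hu => ⟨M.c - (i + 1), by omega, i + 1, hb, rfl, M.f i, rfl, ?_⟩,
      fun hu => ⟨fun hlt => ⟨M.c - (i + 1), by omega, i + 1, hb, rfl, M.f i, rfl, ?_⟩,
      fun hge => ⟨M.c - (i + 1), by omega, i + 1, hb, rfl, u, rfl, ?_⟩⟩⟩⟩
    · rcases hinv with ⟨h1, h2⟩ | ⟨h1, ⟨b, hb, h2⟩, h3⟩
      · refine Or.inl ⟨h1, fun b hb => ?_⟩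
        rcases Nat.lt_succ_iff_lt_or_eq.1 hb with hb | rfl
        exacts [h2 b hb, hf]
      · refine Or.inr ⟨h1, ⟨b, by omega, h2⟩, fun b hb hfb => ?_⟩
        rcases Nat.lt_succ_iff_lt_or_eq.1 hb with hb | rfl
        exacts [h3 b hb hfb, absurd hfb hf.not_gt]
    · refine Or.inr ⟨hf, ⟨i, Nat.lt_succ_self i, rfl⟩, fun b hb hfb => ?_⟩
      rcases Nat.lt_succ_iff_lt_or_eq.1 hb with hb | rfl
      · rcases hinv with ⟨_, h2⟩ | ⟨h1, _⟩
        · exact absurd hfb (h2 b hb).not_gt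
        · exact absurd h1 hu.not_gt
      · exact le_rfl
    · refine Or.inr ⟨hf, ⟨i, Nat.lt_succ_self i, rfl⟩, fun b hb hfb => ?_⟩
      rcases Nat.lt_succ_iff_lt_or_eq.1 hb with hb | rfl
      · rcases hinv with ⟨h1, h2⟩ | ⟨_, _, h3⟩
        · exact absurd hfb (h2 b hb).not_gt
        · exact hlt.le.trans (h3 b hb hfb)
      · exact le_rfl
    · rcases hinv with ⟨h1, h2⟩ | ⟨h1, ⟨b, hb, h2⟩, h3⟩
      · exact absurd h1 hu.ne'
      · refine Or.inr ⟨h1, ⟨b, by omega, h2⟩, fun b hb hfb => ?_⟩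
        rcases Nat.lt_succ_iff_lt_or_eq.1 hb with hb | rfl
        exacts [h3 b hb hfb, hge]
  · cases M; simp_all
  · rintro M' ⟨⟨N, i, hi, _, u, rfl, hinv⟩, hb⟩
    simp only [holds_natLt, eval_i, eval_c] at hb
    obtain rfl : i = M.c := by omega
    exact ⟨u, rfl, hinv⟩

/-- The assignment invariant in terms of the memory. -/
def Mem.Assigning (I : RigidInstance) (M : Mem) : Prop :=
  AssignInv (I.data M.ord) (M.dur I) M.k M.t M.i M.rem M.c M.slo M.shi M.f M.off M.Uses

/-- Records name jobs, not positions. Since the order is injective below `n`, the new record belongs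
to position `k` alone; beyond `n` the array `ord` is unconstrained, hence the restriction on `i`. -/
theorem Mem.uses_record {I : RigidInstance} {M M' : Mem} (ho : Sorted I M.ord) (hk : M.k < I.n)
    {x y : ℕ} (hord : M'.ord = M.ord) (hB : M'.B = M.B + 1)
    (hrj : M'.rj = Function.update M.rj M.B (M.ord M.k))
    (hlo : M'.rlo = Function.update M.rlo M.B x) (hhi : M'.rhi = Function.update M.rhi M.B y)
    (i : ℕ) (hi : i < I.n) (q : ℕ) :
    M'.Uses i q ↔ M.Uses i q ∨ (i = M.k ∧ x ≤ q ∧ q < y) := by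
  constructor
  · rintro ⟨b, hb, h1, h2, h3⟩
    rw [hB] at hb
    rw [hrj, hord] at h1
    rw [hlo] at h2
    rw [hhi] at h3
    by_cases hbB : b = M.B
    · subst hbB
      simp only [Function.update_self] at h1 h2 h3
      exact Or.inr ⟨(ho.inj _ hk _ hi h1).symm, h2, h3⟩
    · simp only [Function.update_of_ne hbB] at h1 h2 h3
      exact Or.inl ⟨b, by omega, h1, h2, h3⟩
  · rintro (⟨b, hb, h1, h2, h3⟩ | ⟨rfl, h2, h3⟩)
    · refine ⟨b, by omega, ?_⟩
      rw [hrj, hord, hlo, hhi]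
      simp only [Function.update_of_ne hb.ne]
      exact ⟨h1, h2, h3⟩
    · refine ⟨M.B, by omega, ?_⟩
      rw [hrj, hord, hlo, hhi]
      simp only [Function.update_self]
      exact ⟨trivial, h2, h3⟩

/-- The number of iterations that are left in the assignment loop. -/
def Mem.assignLeft (M : Mem) : ℕ := M.c + (if 0 < M.rem then 1 else 0) - M.i

/-- The memory after segment `i` has been split. -/
def Mem.split (M : Mem) : Mem :=
  { M with
    slo := Function.update M.slo M.c (M.slo M.i + M.rem)
    shi := Function.update (Function.update M.shi M.c (M.shi M.i)) M.i
      (Function.update M.slo M.c (M.slo M.i + M.rem) M.i + M.rem)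
    f := Function.update M.f M.c (M.f M.i)
    c := M.c + 1 }

/-- The memory after segment `i` has been assigned to the job at position `k`. -/
noncomputable def Mem.take (I : RigidInstance) (M : Mem) : Mem :=
  { M with
    B := M.B + 1
    rj := Function.update M.rj M.B (M.ord M.k)
    rlo := Function.update M.rlo M.B (M.slo M.i)
    rhi := Function.update M.rhi M.B (M.shi M.i)
    f := Function.update M.f M.i (M.t + M.dur I M.k)
    rem := M.rem - (M.shi M.i - M.slo M.i)
    i := M.i + 1 }

theorem Mem.Assigning.take {I : RigidInstance} {M : Mem} (ho : Sorted I M.ord) (hk : M.k < I.n)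
    (hp : 0 < M.dur I M.k) (h : M.Assigning I) (hi : M.i < M.c) (hf : M.f M.i ≤ M.t)
    (hlen : M.shi M.i - M.slo M.i ≤ M.rem) : (M.take I).Assigning I := by
  have hc := h.c_le
  refine AssignInv.take h hk hp h.placement hi (fun _ _ => ⟨rfl, rfl⟩) rfl hf hlen ?_ h.enough rfl
    (Mem.uses_record ho hk rfl rfl rfl rfl rfl)
  change M.c + _ ≤ M.k + 2
  split_ifs at hc ⊢ <;> omega

/-- A split occurs only if the segment exceeds the remaining demand, which is then met completely.
So each job causes at most one split, and the reserved segment suffices. -/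
theorem Mem.Assigning.split_take {I : RigidInstance} {M : Mem} (ho : Sorted I M.ord)
    (hk : M.k < I.n) (hp : 0 < M.dur I M.k) (h : M.Assigning I) (hi : M.i < M.c)
    (hf : M.f M.i ≤ M.t) (hr : 0 < M.rem) (hlen : M.rem < M.shi M.i - M.slo M.i) :
    (M.split.take I).Assigning I ∧ (M.split.take I).rem = 0 := by
  have hci : M.i ≠ M.c := hi.ne
  have hlo : M.split.slo M.i = M.slo M.i := by simp [Mem.split, hci]
  have hhi : M.split.shi M.i = M.slo M.i + M.rem := by simp [Mem.split, hci]
  have hfi : M.split.f M.i = M.f M.i := by simp [Mem.split, hci]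
  have hlen' : M.split.shi M.i - M.split.slo M.i = M.rem := by rw [hlo, hhi]; omega
  have hc := h.c_le
  rw [if_pos hr] at hc
  -- As in the program, `Mem.split` reads `slo` at `i` after the write at `c`; since `i ≠ c` this is
  -- the old value.
  have hshi : M.split.shi = Function.update (Function.update M.shi M.c (M.shi M.i)) M.i
      (M.slo M.i + M.rem) := by
    simp [Mem.split, hci]
  have hpl := AssignInv.split h hi hf hlen
  rw [← hshi] at hpl
  have hi' : M.i < M.split.c := hi.trans (Nat.lt_succ_self _)
  have hfi' : M.split.f M.i ≤ M.t := hfi ▸ hf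
  refine ⟨AssignInv.take (K := M.k) (t := M.t) (a := M.i) (r := M.rem) (c' := M.split.c)
    (slo' := M.split.slo) (shi' := M.split.shi) (f' := M.split.f) (off := M.off)
    h hk hp hpl hi' (fun b hb => ?_) ?_ hfi' hlen'.le ?_ ?_ rfl
    (Mem.uses_record ho hk rfl rfl rfl rfl rfl), ?_⟩
  · have h1 : b ≠ M.c := by omega
    have h2 : b ≠ M.i := by omega
    simp [Mem.split, h1, h2]
  · rw [hshi]
    exact sum_split hi hlen.le M.f fun x => max (x - M.t) 0
  · rw [hlen', Nat.sub_self]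
    simpa [Mem.split] using hc
  · rw [avail_step hi', if_pos hfi', hlen']
    exact Nat.le_add_right _ _
  · change M.rem - (M.split.shi M.i - M.split.slo M.i) = 0
    rw [hlen', Nat.sub_self]

theorem runs_assignBody {I : RigidInstance} {M : Mem} (ho : Sorted I M.ord) (hk : M.k < I.n)
    (hp : 0 < M.dur I M.k) (h : M.Assigning I) (hi : M.i < M.c) :
    Runs I assignBody M 200 fun M' => M'.Assigning I ∧ M'.assignLeft < M.assignLeft ∧
      M'.ord = M.ord ∧ M'.k = M.k ∧ M'.t = M.t ∧ M'.v = M.v ∧ M'.off = M.off := by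
  refine Runs.of_wp ?_ (by decide)
  simp only [assignBody, splitProg, takeProg, Program.wp, wp_incr, wp_setN, holds_realLe,
    holds_natLt, eval_f, eval_i, eval_t, eval_rem, eval_nconst, eval_lenExpr, eval_c, eval_nadd,
    eval_slo, eval_shi, eval_B, eval_jobExpr, eval_radd, eval_durExpr,
    write_slo, write_shi, write_f, write_c, write_rj, write_rlo, write_rhi, write_rem, write_B,
    write_i, post_enc, and_true]
  refine ⟨fun hf => ⟨fun hr => ⟨fun hlt => ?_, fun hge => ?_⟩, fun hr => ?_⟩, fun hf => ?_⟩
  · obtain ⟨h1, h2⟩ := h.split_take ho hk hp hi hf hr hlt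
    refine ⟨h1, ?_⟩
    -- The additional segment is offset by the term for `0 < rem`, which vanishes, so the index step
    -- makes the count fall.
    change (M.split.take I).assignLeft < M.assignLeft
    rw [Mem.assignLeft, Mem.assignLeft, h2, if_pos hr, if_neg (lt_irrefl 0)]
    change M.c + 1 + 0 - (M.i + 1) < M.c + 1 - M.i
    omega
  · refine ⟨h.take ho hk hp hi hf (not_lt.1 hge), ?_⟩
    simp only [Mem.assignLeft]
    split_ifs <;> omega
  · have hr : M.rem = 0 := by omega
    refine ⟨AssignInv.skip h hi (Or.inr hr), ?_⟩
    simp only [Mem.assignLeft]; omega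
  · refine ⟨AssignInv.skip h hi (Or.inl (not_le.1 hf)), ?_⟩
    simp only [Mem.assignLeft]; omega

theorem Mem.dur_congr {I : RigidInstance} {M M' : Mem} (h1 : M'.ord = M.ord) (h2 : M'.v = M.v) :
    M'.dur I = M.dur I := by
  funext i; rw [Mem.dur, Mem.dur, h1, h2]

theorem runs_assignLoop {I : RigidInstance} {M : Mem} (ho : Sorted I M.ord) (hk : M.k < I.n)
    (hp : 0 < M.dur I M.k) (h : M.Assigning I) :
    Runs I (.loop (.natLt (nv 11) (nv 15)) assignBody) M ((I.n + 1) * 205 + 5) fun M' =>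
      M'.Assigning I ∧ M'.c ≤ M'.i ∧
      M'.ord = M.ord ∧ M'.k = M.k ∧ M'.t = M.t ∧ M'.v = M.v ∧ M'.off = M.off := by
  refine Runs.mono (Runs.loop (T := 200)
    (fun N M' => N = M'.assignLeft ∧ M'.Assigning I ∧
      M'.ord = M.ord ∧ M'.k = M.k ∧ M'.t = M.t ∧ M'.v = M.v ∧ M'.off = M.off)
    ?_ _ M ⟨rfl, h, rfl, rfl, rfl, rfl, rfl⟩) ?_ ?_
  · rintro N M' ⟨rfl, h0, h1, h2, h3, h4, h5⟩ hb
    simp only [holds_natLt, eval_i, eval_c] at hb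
    refine Runs.mono (runs_assignBody (h1 ▸ ho) (h2 ▸ hk) ?_ h0 hb) le_rfl ?_
    · rw [h2, Mem.dur_congr h1 h4]; exact hp
    · rintro M'' ⟨h0', hl, h1', h2', h3', h4', h5'⟩
      exact ⟨_, hl, rfl, h0', h1'.trans h1, h2'.trans h2, h3'.trans h3, h4'.trans h4, h5'.trans h5⟩
  · have hc := h.c_le
    have : M.assignLeft ≤ I.n + 1 := by rw [Mem.assignLeft]; omega
    exact Nat.add_le_add_right (Nat.mul_le_mul_right 205 this) 5
  · rintro M' ⟨⟨N, _, h0, h1⟩, hb⟩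
    simp only [holds_natLt, eval_i, eval_c] at hb
    exact ⟨h0, not_lt.1 hb, h1⟩

/-- The invariant of list scheduling in terms of the memory. -/
def Mem.Listing (I : RigidInstance) (M : Mem) : Prop :=
  ListInv (I.data M.ord) (M.dur I) M.k M.t M.c M.slo M.shi M.f M.off M.Uses

/-- A bound for the number of iterations that are left in the main loop of list scheduling. -/
noncomputable def Mem.listLeft (I : RigidInstance) (M : Mem) : ℕ :=
  2 * (I.n - M.k) + pending (M.dur I) M.k M.off M.t

theorem runs_advanceProg {I : RigidInstance} (hJ : ∀ o, Sorted I o → (I.data o).Valid) {M : Mem}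
    (ho : Sorted I M.ord) (hk : M.k < I.n) (h : M.Listing I)
    (hfree : avail 0 M.c M.slo M.shi M.f M.t < I.sz (M.ord M.k)) :
    Runs I advanceProg M ((I.n + 1) * 55 + 50) fun M' => M'.Listing I ∧
      M'.listLeft I < M.listLeft I ∧ M'.ord = M.ord ∧ M'.v = M.v := by
  have hc : M.c ≤ I.n + 1 := by have := h.c_le; omega
  refine Runs.mono (Runs.seq (Q := fun M' => M' = { M with u := M.t, i := 0 })
    (T := 20) (T' := (M.c * 55 + 5) + 20) (Runs.of_wp (by simp) (by decide)) ?_) ?_ fun _ h => h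
  · rintro M' rfl
    refine Runs.seq (runs_nextLoop I _ rfl rfl) ?_
    rintro M' ⟨u, rfl, hu⟩
    refine Runs.of_wp ?_ (by decide)
    simp only [wp_setR, eval_u, write_t, post_enc, and_true]
    obtain ⟨b, hb, hfb⟩ := h.exists_busy (hJ _ ho) hk hfree
    obtain ⟨h1, h2, h3⟩ := hu.resolve_left fun hu => (hu.2 b hb).not_gt hfb
    obtain ⟨h4, h5⟩ := h.advance (hJ _ ho) hk hfree h1 h2 h3
    exact ⟨h4, Nat.add_lt_add_left h5 _⟩
  · have := Nat.mul_le_mul_right 55 hc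
    omega

theorem runs_placeProg {I : RigidInstance} (hJ : ∀ o, Sorted I o → (I.data o).Valid) {M : Mem}
    (ho : Sorted I M.ord) (hp : ∀ j < I.n, 0 < M.dur I j)
    (hd : (I.data M.ord).Durations (M.dur I)) (hk : M.k < I.n) (h : M.Listing I)
    (hfree : I.sz (M.ord M.k) ≤ avail 0 M.c M.slo M.shi M.f M.t) :
    Runs I placeProg M ((I.n + 1) * 205 + 50) fun M' => M'.Listing I ∧
      M'.listLeft I < M.listLeft I ∧ M'.ord = M.ord ∧ M'.v = M.v := by
  refine Runs.mono (Runs.seq (Q := fun M' => M' = { M with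
      rem := I.sz (M.ord M.k), i := 0, off := Function.update M.off M.k M.t })
    (T := 20) (T' := ((I.n + 1) * 205 + 5) + 20) (Runs.of_wp (by simp) (by decide)) ?_) (by omega)
    fun _ h => h
  rintro M' rfl
  refine Runs.seq (runs_assignLoop (M := { M with
      rem := I.sz (M.ord M.k), i := 0, off := Function.update M.off M.k M.t }) ho hk (hp _ hk)
    (h.assign (hJ _ ho) hk hfree)) ?_
  rintro M' ⟨h0, hci, h1, h2, h3, h4, h5⟩
  dsimp only at h1 h2 h3 h4 h5
  have hdur := Mem.dur_congr (I := I) h1 h4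
  rw [Mem.Assigning] at h0
  have h0' := h0.finish (hJ _ (h1 ▸ ho)) (by rw [h1, hdur]; exact hd) (h2 ▸ hk) hci
  refine Runs.of_wp ?_ (by decide)
  simp only [wp_incr, eval_k, write_k, post_enc]
  refine ⟨h0', ?_, h1, h4⟩
  have := pending_succ_le (M.dur I) M.k M.off M.t M.t
  have h6 : Mem.listLeft I { M' with k := M'.k + 1 } = 2 * (I.n - (M.k + 1))
      + pending (M.dur I) (M.k + 1) (Function.update M.off M.k M.t) M.t := by
    rw [← h5, ← h2, ← h3, ← hdur]; rfl
  rw [h6, Mem.listLeft]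
  omega

theorem runs_listBody {I : RigidInstance} (hJ : ∀ o, Sorted I o → (I.data o).Valid) {M : Mem}
    (ho : Sorted I M.ord) (hp : ∀ j < I.n, 0 < M.dur I j)
    (hd : (I.data M.ord).Durations (M.dur I)) (hk : M.k < I.n) (h : M.Listing I) :
    Runs I listBody M ((I.n + 1) * 250 + 100) fun M' => M'.Listing I ∧
      M'.listLeft I < M.listLeft I ∧ M'.ord = M.ord ∧ M'.v = M.v := by
  have hc : M.c ≤ I.n + 1 := by have := h.c_le; omega
  refine Runs.mono (Runs.seq (Q := fun M' => M' = { M with r := 0, i := 0 })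
    (T := 20) (T' := (M.c * 45 + 5) + (10 + ((I.n + 1) * 205 + 50)))
    (Runs.of_wp (by simp) (by decide)) ?_) ?_ fun _ h => h
  · rintro M' rfl
    refine Runs.seq (runs_countLoop I _ rfl rfl) ?_
    rintro M' rfl
    refine Runs.mono (Runs.cond (T := (I.n + 1) * 205 + 50) (fun hb => ?_) fun hb => ?_)
      (Nat.add_le_add_right (by decide) _) fun _ h => h
    · simp only [holds_natLt, eval_r, eval_sz, eval_jobExpr] at hb
      exact (runs_advanceProg hJ (M := { M with
        i := M.c, r := avail 0 M.c M.slo M.shi M.f M.t }) ho hk h hb).mono (by omega) fun _ h => h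
    · simp only [holds_natLt, eval_r, eval_sz, eval_jobExpr, not_lt] at hb
      exact runs_placeProg hJ (M := { M with
        i := M.c, r := avail 0 M.c M.slo M.shi M.f M.t }) ho hp hd hk h hb
  · have := Nat.mul_le_mul_right 45 hc
    omega

theorem listing_init {I : RigidInstance} {M : Mem} (hB : M.B = 0) (hlo : M.slo 0 = 0)
    (hhi : M.shi 0 = I.m) (hf : M.f 0 = 0) (hc : M.c = 1) (ht : M.t = 0) (hk : M.k = 0) :
    M.Listing I := by
  have hR : ∀ i q, ¬ M.Uses i q := fun i q => by
    rintro ⟨b, hb, _⟩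
    omega
  rw [Mem.Listing, hc, ht, hk]
  refine ⟨Nat.zero_le _, ⟨⟨?_, ?_, ?_, ?_⟩, ?_, fun i _ _ => hR i, by simp, by simp, by simp⟩,
    le_rfl, le_rfl, by simp, ?_⟩
  · simp [hlo]
  · simp [hhi, RigidInstance.data]
  · simp [hlo, hhi, RigidInstance.data]
  · intro b hb b' hb'; omega
  · intro b hb
    obtain rfl : b = 0 := by omega
    exact Or.inl hf.le
  · simp [busy, hf]

theorem runs_listProg {I : RigidInstance} (hJ : ∀ o, Sorted I o → (I.data o).Valid) {M : Mem}
    (ho : Sorted I M.ord) (hp : ∀ j < I.n, 0 < M.dur I j)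
    (hd : (I.data M.ord).Durations (M.dur I)) :
    Runs I listProg M (40 + (2 * I.n * (5 + ((I.n + 1) * 250 + 100)) + 5)) fun M' =>
      M'.Listing I ∧ M'.k = I.n ∧ M'.ord = M.ord ∧ M'.v = M.v := by
  refine Runs.seq (Q := fun M' => M'.Listing I ∧ M'.k = 0 ∧ M'.ord = M.ord ∧ M'.v = M.v)
    (Runs.of_wp ?_ (by decide)) ?_
  · simp only [Program.wp, wp_setN, wp_setR, eval_nconst, eval_m, eval_ofNat, write_B, write_slo,
      write_shi, write_f, write_c, write_t, write_k, post_enc, and_true]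
    apply listing_init <;> simp
  · rintro M1 ⟨h1, h2, h3, h4⟩
    refine Runs.mono (Runs.loop (T := (I.n + 1) * 250 + 100)
      (fun N M' => N = M'.listLeft I ∧ M'.Listing I ∧ M'.ord = M.ord ∧ M'.v = M.v)
      ?_ _ M1 ⟨rfl, h1, h3, h4⟩) ?_ ?_
    · rintro N M' ⟨rfl, h5, h6, h7⟩ hb
      simp only [holds_natLt, eval_k, eval_n] at hb
      have hdur := Mem.dur_congr (I := I) h6 h7
      refine Runs.mono (runs_listBody hJ (h6 ▸ ho) (hdur ▸ hp) (by rw [h6, hdur]; exact hd) hb h5)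
        le_rfl ?_
      rintro M'' ⟨h8, h9, h10, h11⟩
      exact ⟨_, h9, rfl, h8, h10.trans h6, h11.trans h7⟩
    · have : M1.listLeft I = 2 * I.n := by simp [Mem.listLeft, h2, pending]
      rw [this]
      rfl
    · rintro M' ⟨⟨N, _, h5, h6, h7⟩, hb⟩
      simp only [holds_natLt, eval_k, eval_n, not_lt] at hb
      exact ⟨h5, le_antisymm h5.le_n hb, h6, h7⟩

open MeasureTheory

/-! ## The lower bound for the energy -/

/-- Bernoulli's inequality for y / v: the convex function y^α lies above its tangent at `v`. -/
theorem young_tangent {α v y : ℝ} (hα : 1 < α) (hv : 0 < v) (hy : 0 ≤ y) :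
    α * v ^ (α - 1) * y ≤ y ^ α + (α - 1) * v ^ α := by
  have h := one_add_mul_self_le_rpow_one_add (s := y / v - 1) (p := α)
    (by have := div_nonneg hy hv.le; linarith) hα.le
  have h1 : (1 : ℝ) + (y / v - 1) = y / v := by ring
  rw [h1, Real.div_rpow hy hv.le, le_div_iff₀ (Real.rpow_pos_of_pos hv α)] at h
  have h2 : v ^ α = v ^ (α - 1) * v := by
    rw [← Real.rpow_add_one hv.ne']; ring_nf
  have h3 : (1 + α * (y / v - 1)) * v ^ α = α * v ^ (α - 1) * y - (α - 1) * v ^ α := by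
    rw [h2]; field_simp; ring
  linarith

/-- The integrated tangent inequality bounds the energy by a function linear in the duration,
whatever the speed profile. It is stated additively because the energy may be infinite and
subtraction in `ℝ≥0∞` truncates. -/
theorem job_energy_ge {sp : ℝ → ℝ≥0} (hsp : Measurable sp) {s f W α v : ℝ}
    (hW : ∫⁻ t in Set.Ico s f, (sp t : ℝ≥0∞) = ENNReal.ofReal W) (hα : 1 < α) (hv : 0 < v) :
    ENNReal.ofReal (α * v ^ (α - 1) * W) ≤
      (∫⁻ t in Set.Ico s f, ((sp t ^ α : ℝ≥0) : ℝ≥0∞))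
        + ENNReal.ofReal ((α - 1) * v ^ α * (f - s)) := by
  have hc : 0 ≤ α * v ^ (α - 1) := by positivity
  have hd : 0 ≤ (α - 1) * v ^ α := mul_nonneg (by linarith) (by positivity)
  rw [ENNReal.ofReal_mul hc, ← hW, ← lintegral_const_mul _ hsp.coe_nnreal_ennreal,
    ENNReal.ofReal_mul hd, ← Real.volume_Ico, ← setLIntegral_const,
    ← lintegral_add_right _ measurable_const]
  refine lintegral_mono fun t => ?_
  have h := young_tangent hα hv (sp t).coe_nonneg
  have h1 : ((sp t : ℝ≥0) : ℝ≥0∞) = ENNReal.ofReal (sp t : ℝ) := by simp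
  have h2 : ((sp t ^ α : ℝ≥0) : ℝ≥0∞) = ENNReal.ofReal ((sp t : ℝ) ^ α) := by
    rw [← NNReal.coe_rpow, ENNReal.ofReal_coe_nnreal]
  dsimp only
  rw [h1, h2, ← ENNReal.ofReal_mul hc, ← ENNReal.ofReal_add (by positivity) hd]
  exact ENNReal.ofReal_le_ofReal h

/-- On each processor the execution intervals are disjoint parts of `[a, b)`, so their lengths add
up to at most `b - a`; then sum over the processors. -/
theorem Schedule.Feasible.load_le {I : RigidInstance} {S : Schedule I} (hS : S.Feasible)
    (P : Finset (Fin I.n)) {a b : ℝ} (hab : a ≤ b) (ha : ∀ i ∈ P, a ≤ I.release i)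
    (hb : ∀ i ∈ P, I.deadline i ≤ b) :
    ∑ i ∈ P, (I.size i : ℝ) * (S.finish i - S.start i) ≤ I.m * (b - a) := by
  classical
  have h1 : ∀ i ∈ P, (I.size i : ℝ) * (S.finish i - S.start i)
      = ∑ q : Fin I.m, if q ∈ S.procs i then S.finish i - S.start i else 0 := by
    intro i _
    rw [← Finset.sum_filter, Finset.filter_mem_eq_inter, Finset.univ_inter, Finset.sum_const,
      hS.card_procs, nsmul_eq_mul]
  rw [Finset.sum_congr rfl h1, Finset.sum_comm]
  have h2 : ∀ q : Fin I.m,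
      (∑ i ∈ P, if q ∈ S.procs i then S.finish i - S.start i else 0) ≤ b - a := by
    intro q
    rw [← Finset.sum_filter]
    have h3 : ∀ i ∈ P.filter (fun i => q ∈ S.procs i), S.finish i - S.start i
        = volume.real (Set.Ico (S.start i) (S.finish i)) := by
      intro i _
      rw [Real.volume_real_Ico_of_le (hS.start_le_finish i)]
    rw [Finset.sum_congr rfl h3, ← measureReal_biUnion_finset (h := fun _ _ => by simp), ← Real.volume_real_Ico_of_le hab]
    · refine measureReal_mono (Set.iUnion₂_subset fun i hi => ?_) (by simp)
      have hi := (Finset.mem_filter.1 hi).1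
      exact Set.Ico_subset_Ico ((ha i hi).trans (hS.release_le_start i))
        ((hS.finish_le_deadline i).trans (hb i hi))
    · intro i hi j hj hij
      exact hS.no_overlap i j hij q (Finset.mem_filter.1 (Finset.mem_coe.1 hi)).2
        (Finset.mem_filter.1 (Finset.mem_coe.1 hj)).2
    · exact fun _ _ => measurableSet_Ico
  refine (Finset.sum_le_sum fun q _ => h2 q).trans (le_of_eq ?_)
  rw [Finset.sum_const, Finset.card_univ, Fintype.card_fin, nsmul_eq_mul]

theorem Sorted.sum_range {I : RigidInstance} {o : ℕ → ℕ} (ho : Sorted I o) {A : Type}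
    [AddCommMonoid A] (F : ℕ → A) {K : ℕ} (hK : K ≤ I.n)
    [DecidablePred fun i : Fin I.n => ∃ j < K, o j = i] :
    ∑ j ∈ Finset.range K, F (o j)
      = ∑ i ∈ Finset.univ.filter (fun i : Fin I.n => ∃ j < K, o j = i), F i := by
  have hlt : ∀ j ∈ Finset.range K, j < I.n := fun j hj => (Finset.mem_range.1 hj).trans_le hK
  refine Finset.sum_bij (fun j hj => (⟨o j, ho.lt j (hlt j hj)⟩ : Fin I.n)) ?_ ?_ ?_ ?_
  · intro j hj
    simpa using ⟨j, Finset.mem_range.1 hj, rfl⟩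
  · intro j hj j' hj' h
    exact ho.inj j (hlt j hj) j' (hlt j' hj') (congrArg Fin.val h)
  · intro i hi
    obtain ⟨j, hj, h⟩ := (Finset.mem_filter.1 hi).2
    exact ⟨j, Finset.mem_range.2 hj, Fin.ext h⟩
  · exact fun _ _ => rfl

theorem Sorted.sum_univ {I : RigidInstance} {o : ℕ → ℕ} (ho : Sorted I o) {A : Type}
    [AddCommMonoid A] (F : ℕ → A) :
    ∑ j ∈ Finset.range I.n, F (o j) = ∑ i : Fin I.n, F i := by
  classical
  rw [ho.sum_range F le_rfl, Finset.filter_true_of_mem]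
  exact fun i _ => ho.surj i i.2

/-- Shorter time windows are contained in longer ones. -/
def RigidInstance.Nested (I : RigidInstance) : Prop :=
  ∀ i j : Fin I.n, I.win i ≤ I.win j → I.release j ≤ I.release i ∧ I.deadline i ≤ I.deadline j

/-- The time that job `j` takes in the schedule `S`, for all natural numbers `j`. -/
noncomputable def Schedule.time {I : RigidInstance} (S : Schedule I) (j : ℕ) : ℝ :=
  if h : j < I.n then S.finish ⟨j, h⟩ - S.start ⟨j, h⟩ else 0

theorem Schedule.time_val {I : RigidInstance} (S : Schedule I) (j : Fin I.n) :
    S.time j = S.finish j - S.start j := by simp [time]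

/-- By nestedness the jobs up to position `k` all have their windows inside that of job `k`. This is
the only use of nestedness. -/
theorem Schedule.Feasible.durations {I : RigidInstance} (hI : I.Nested) {o : ℕ → ℕ}
    (ho : Sorted I o) {S : Schedule I} (hS : S.Feasible) :
    (I.data o).Durations fun k => S.time (o k) := by
  classical
  refine ⟨fun k hk => ?_, fun k hk => ?_⟩
  · have h := S.time_val ⟨o k, ho.lt k hk⟩
    have h1 := hS.release_le_start ⟨o k, ho.lt k hk⟩
    have h2 := hS.finish_le_deadline ⟨o k, ho.lt k hk⟩
    have h3 := I.rl_val ⟨o k, ho.lt k hk⟩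
    have h4 := I.dl_val ⟨o k, ho.lt k hk⟩
    simp only at h h3 h4
    change S.time (o k) ≤ I.dl (o k) - I.rl (o k)
    linarith
  · have hk' : k < I.n := hk
    have h := ho.sum_range (fun j => (I.sz j : ℝ) * S.time j) (K := k + 1) hk'
    change ∑ j ∈ Finset.range (k + 1), (I.sz (o j) : ℝ) * S.time (o j) ≤ I.m * I.win (o k)
    rw [h]
    set l : Fin I.n := ⟨o k, ho.lt k hk'⟩ with hl
    have hw : I.win (o k) = I.deadline l - I.release l := by
      rw [← I.dl_val l, ← I.rl_val l]; rfl
    have hn : ∀ i ∈ Finset.univ.filter (fun i : Fin I.n => ∃ j < k + 1, o j = i),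
        I.release l ≤ I.release i ∧ I.deadline i ≤ I.deadline l := by
      intro i hi
      obtain ⟨j, hj, hji⟩ := (Finset.mem_filter.1 hi).2
      refine hI i l ?_
      rw [← hji]
      exact ho.mono j k (by omega) hk'
    rw [hw]
    refine le_trans (le_of_eq (Finset.sum_congr rfl fun i _ => ?_))
      (hS.load_le _ (I.release_lt_deadline l).le (fun i hi => (hn i hi).1)
        (fun i hi => (hn i hi).2))
    rw [I.sz_val, S.time_val]

/-- Let E be the energy at the optimal speeds. Adding the tangent inequalities at these speeds gives
energy ≥ αE - (α-1) Σ size_j v_j^α q_j, and optimality with exponent α bounds the last sum by E. The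
function `x` is `v` indexed by jobs instead of positions. -/
theorem JobData.Optimal.energy_le {I : RigidInstance} (hI : I.Nested) {o : ℕ → ℕ}
    (ho : Sorted I o) {v : ℕ → ℝ} (hv : (I.data o).Optimal v) {S : Schedule I}
    (hS : S.Feasible) {α : ℝ} (hα : 1 < α) {x : ℕ → ℝ} (hx : ∀ k < I.n, x (o k) = v k) :
    ENNReal.ofReal (∑ j : Fin I.n, (I.size j : ℝ) * (x j ^ (α - 1) * I.work j))
      ≤ S.energy α := by
  have hxp : ∀ j : Fin I.n, 0 < x j := by
    intro j
    obtain ⟨k, hk, hkj⟩ := ho.surj j j.2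
    rw [← hkj, hx k hk]
    exact hv.pos k hk
  have hxa : ∀ j : Fin I.n, x j ^ α * (I.work j / x j) = x j ^ (α - 1) * I.work j := by
    intro j
    have := hxp j
    rw [Real.rpow_sub_one this.ne']
    field_simp
  have hopt := hv.opt _ (hS.durations hI ho) α (by linarith)
  have hsum : ∑ j : Fin I.n, (I.size j : ℝ) * (x j ^ α * (S.finish j - S.start j))
      ≤ ∑ j : Fin I.n, (I.size j : ℝ) * (x j ^ (α - 1) * I.work j) := by
    rw [← sub_nonpos, ← Finset.sum_sub_distrib]
    refine le_trans (le_of_eq ?_) hopt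
    have h := ho.sum_univ fun j => (I.sz j : ℝ) * x j ^ α * (S.time j - I.wk j / x j)
    refine Eq.trans ?_ (h.symm.trans (Finset.sum_congr rfl fun k hk => ?_))
    · refine Finset.sum_congr rfl fun j _ => ?_
      rw [← hxa j, I.sz_val, S.time_val, I.wk_val]
      ring
    · rw [hx k (Finset.mem_range.1 hk)]
      rfl
  set E := ∑ j : Fin I.n, (I.size j : ℝ) * (x j ^ (α - 1) * I.work j) with hE
  have hEn : 0 ≤ E := by
    refine Finset.sum_nonneg fun j _ => ?_
    have := hxp j
    have := I.work_pos j
    positivity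
  have hjob : ∀ j : Fin I.n,
      ENNReal.ofReal ((I.size j : ℝ) * (α * x j ^ (α - 1) * I.work j)) ≤
      (I.size j : ℝ≥0∞) * (∫⁻ t in Set.Ico (S.start j) (S.finish j),
        ((S.speed j t ^ α : ℝ≥0) : ℝ≥0∞))
        + ENNReal.ofReal ((I.size j : ℝ) * ((α - 1) * x j ^ α * (S.finish j - S.start j))) := by
    intro j
    have h := job_energy_ge (hS.measurable_speed j) (hS.work_done j) hα (hxp j)
    rw [ENNReal.ofReal_mul (Nat.cast_nonneg _), ENNReal.ofReal_mul (Nat.cast_nonneg _),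
      ENNReal.ofReal_natCast, ← mul_add]
    gcongr
  have htot : ENNReal.ofReal (α * E) ≤ S.energy α + ENNReal.ofReal ((α - 1) * E) := by
    have h := Finset.sum_le_sum fun j (_ : j ∈ Finset.univ) => hjob j
    rw [Finset.sum_add_distrib, ← ENNReal.ofReal_sum_of_nonneg, ← ENNReal.ofReal_sum_of_nonneg] at h
    · have h1 : ∑ j : Fin I.n, (I.size j : ℝ) * (α * x j ^ (α - 1) * I.work j) = α * E := by
        rw [hE, Finset.mul_sum]
        exact Finset.sum_congr rfl fun j _ => by ring
      have h2 : ∑ j : Fin I.n, (I.size j : ℝ) * ((α - 1) * x j ^ α * (S.finish j - S.start j))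
          ≤ (α - 1) * E := by
        refine le_trans (le_of_eq ?_) (mul_le_mul_of_nonneg_left hsum (by linarith))
        rw [Finset.mul_sum]
        exact Finset.sum_congr rfl fun j _ => by ring
      rw [h1] at h
      exact h.trans (add_le_add le_rfl (ENNReal.ofReal_le_ofReal h2))
    · intro j _
      have h1 := hxp j
      have h2 := hS.start_le_finish j
      have h3 : 0 ≤ (α - 1) * x j ^ α := mul_nonneg (by linarith) (by positivity)
      exact mul_nonneg (Nat.cast_nonneg _) (mul_nonneg h3 (by linarith))
    · intro j _
      have h1 := hxp j
      have h2 := I.work_pos j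
      positivity
  have hsplit : ENNReal.ofReal (α * E) = ENNReal.ofReal E + ENNReal.ofReal ((α - 1) * E) := by
    rw [← ENNReal.ofReal_add hEn (mul_nonneg (by linarith) hEn)]
    congr 1; ring
  rw [hsplit] at htot
  exact (ENNReal.add_le_add_iff_right ENNReal.ofReal_ne_top).1 htot

/-! ## The schedule that is computed -/

/-- The factor by which the optimal speeds are increased. -/
noncomputable def RigidInstance.rho (I : RigidInstance) : ℝ := (3 * I.m - 1) / (I.m + 1)

theorem RigidInstance.rho_pos {I : RigidInstance} (hm : 0 < I.m) : 0 < I.rho := by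
  have : (1 : ℝ) ≤ I.m := by exact_mod_cast hm
  exact div_pos (by linarith) (by linarith)

theorem RigidInstance.rho_eq (I : RigidInstance) : 3 - 4 / ((I.m : ℝ) + 1) = I.rho := by
  have : (I.m : ℝ) + 1 ≠ 0 := by positivity
  rw [rho]; field_simp; ring

theorem RigidInstance.m_pos (I : RigidInstance) (j : Fin I.n) : 0 < I.m :=
  (I.size_pos j).trans_le (I.size_le j)

theorem RigidInstance.data_valid {I : RigidInstance} (hI : ∀ j, 2 * I.size j ≤ I.m) {o : ℕ → ℕ}
    (ho : Sorted I o) : (I.data o).Valid := by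
  refine ⟨fun k hk => ?_, fun k hk => ?_, fun k hk => ?_, fun k hk => ?_⟩
  · change 0 < I.sz (o k)
    rw [I.sz_val ⟨o k, ho.lt k hk⟩]; exact I.size_pos _
  · change 2 * I.sz (o k) ≤ I.m
    rw [I.sz_val ⟨o k, ho.lt k hk⟩]; exact hI _
  · change 0 < I.wk (o k)
    rw [I.wk_val ⟨o k, ho.lt k hk⟩]; exact I.work_pos _
  · change 0 < I.dl (o k) - I.rl (o k)
    rw [I.dl_val ⟨o k, ho.lt k hk⟩, I.rl_val ⟨o k, ho.lt k hk⟩]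
    exact sub_pos.2 (I.release_lt_deadline _)

theorem Mem.dur_pos {I : RigidInstance} (hI : ∀ j, 2 * I.size j ≤ I.m) {M : Mem}
    (ho : Sorted I M.ord) (hv : (I.data M.ord).Optimal M.v) (k : ℕ) (hk : k < I.n) :
    0 < M.dur I k :=
  div_pos ((I.data_valid hI ho).w_pos k hk) (hv.pos k hk)

/-- The memory `M'` holds the schedule of the memory `M`, with start times `g` by position. -/
structure Mem.Outputs (I : RigidInstance) (M M' : Mem) (g : ℕ → ℝ) : Prop where
  B : M'.B = M.B
  rj : M'.rj = M.rj
  rlo : M'.rlo = M.rlo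
  rhi : M'.rhi = M.rhi
  speed : ∀ k < I.n, M'.speed (M.ord k) = M.v k * I.rho
  start : ∀ k < I.n, M'.start (M.ord k) = g k

theorem mem_output_procs {I : RigidInstance} {M M' : Mem} {g : ℕ → ℝ}
    (hM : M.Outputs I M' g) {j : Fin I.n} {k : ℕ} (hj : M.ord k = j) (q : Fin I.m) :
    q ∈ (I.output (enc I M')).procs j ↔ M.Uses k q := by
  rw [RigidInstance.output, Finset.mem_filter]
  change _ ∧ (∃ b < M'.B, M'.rj b = (j : ℕ) ∧ M'.rlo b ≤ (q : ℕ) ∧ (q : ℕ) < M'.rhi b) ↔ _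
  rw [hM.B, hM.rj, hM.rlo, hM.rhi, ← hj]
  simp only [Finset.mem_univ, true_and, Mem.Uses]

/-- Dividing all times by ρ keeps the order of executions. The disjunction in `hgg` admits both the
forward placement and the reversed one. -/
theorem output_feasible {I : RigidInstance} (hI : ∀ j, 2 * I.size j ≤ I.m) {M M' : Mem}
    {g : ℕ → ℝ} (ho : Sorted I M.ord) (hv : (I.data M.ord).Optimal M.v) (hL : M.Listing I)
    (hk : M.k = I.n) (hM : M.Outputs I M' g)
    (hg : ∀ k < I.n, I.rl (M.ord k) ≤ g k ∧ g k + M.dur I k / I.rho ≤ I.dl (M.ord k))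
    (hgg : ∀ i < I.n, ∀ j < I.n, M.off i + M.dur I i ≤ M.off j →
      g i + M.dur I i / I.rho ≤ g j ∨ g j + M.dur I j / I.rho ≤ g i) :
    (I.output (enc I M')).Feasible := by
  classical
  have hstart : ∀ (j : Fin I.n) k, k < I.n → M.ord k = j → (I.output (enc I M')).start j = g k := by
    intro j k hk hj
    change M'.start j = _
    rw [← hj, hM.start k hk]
  have hfin : ∀ (j : Fin I.n) k, k < I.n → M.ord k = j →
      (I.output (enc I M')).finish j = g k + M.dur I k / I.rho := by
    intro j k hk hj
    change M'.start j + I.work j / M'.speed j = _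
    rw [← I.wk_val, ← hj, hM.start k hk, hM.speed k hk, Mem.dur, div_div]
    rfl
  have hsp : ∀ j : Fin I.n, 0 < M'.speed j := by
    intro j
    obtain ⟨k, hk, hj⟩ := ho.surj j j.2
    rw [← hj, hM.speed k hk]
    exact mul_pos (hv.pos k hk) (I.rho_pos (I.m_pos j))
  have hdur : ∀ k < I.n, 0 ≤ M.dur I k / I.rho := fun k hk =>
    div_nonneg (Mem.dur_pos hI ho hv k hk).le (I.rho_pos (I.m_pos ⟨k, hk⟩)).le
  refine ⟨fun j => ?_, fun j => ?_, fun j => ?_, fun j => ?_, fun j => measurable_const,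
    fun j => ?_, fun i j hij q hi hj => ?_⟩
  · obtain ⟨k, hkn, hj⟩ := ho.surj j j.2
    have h1 := (hL.placed k (hk ▸ hkn)).card
    change _ = I.sz (M.ord k) at h1
    rw [hj, I.sz_val] at h1
    rw [← h1, ← Finset.card_map Fin.valEmbedding]
    congr 1
    ext q
    simp only [Finset.mem_map, Fin.valEmbedding_apply, Finset.mem_filter, Finset.mem_range,
      mem_output_procs hM hj]
    constructor
    · rintro ⟨q, hq, rfl⟩
      exact ⟨q.2, hq⟩
    · rintro ⟨hq, h⟩
      exact ⟨⟨q, hq⟩, h, rfl⟩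
  · obtain ⟨k, hkn, hj⟩ := ho.surj j j.2
    rw [hstart j k hkn hj, ← I.rl_val, ← hj]
    exact (hg k hkn).1
  · obtain ⟨k, hkn, hj⟩ := ho.surj j j.2
    rw [hstart j k hkn hj, hfin j k hkn hj]
    linarith [hdur k hkn]
  · obtain ⟨k, hkn, hj⟩ := ho.surj j j.2
    rw [hfin j k hkn hj, ← I.dl_val, ← hj]
    exact (hg k hkn).2
  · change ∫⁻ _ in Set.Ico (M'.start j) (M'.start j + I.work j / M'.speed j),
      ((M'.speed j).toNNReal : ℝ≥0∞) = _
    rw [setLIntegral_const, Real.volume_Ico, add_sub_cancel_left]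
    change ENNReal.ofReal _ * _ = _
    rw [← ENNReal.ofReal_mul (hsp j).le]
    congr 1
    have := (hsp j).ne'
    field_simp
  · obtain ⟨k, hkn, hk'⟩ := ho.surj i i.2
    obtain ⟨l, hln, hl'⟩ := ho.surj j j.2
    rw [mem_output_procs hM hk'] at hi
    rw [mem_output_procs hM hl'] at hj
    rw [hstart i k hkn hk', hstart j l hln hl', hfin i k hkn hk', hfin j l hln hl']
    have hkl : k ≠ l := by
      rintro rfl
      exact hij (Fin.ext (hk'.symm.trans hl'))
    have key : g k + M.dur I k / I.rho ≤ g l ∨ g l + M.dur I l / I.rho ≤ g k := by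
      rcases lt_or_gt_of_ne hkl with h | h
      · exact hgg k hkn l hln (hL.placement.disj k l h (hk ▸ hln) q hi hj)
      · exact (hgg l hln k hkn (hL.placement.disj l k h (hk ▸ hkn) q hj hi)).symm
    rw [Set.disjoint_left]
    rintro t ⟨h1, h2⟩ ⟨h3, h4⟩
    rcases key with h | h <;> linarith

/-- A job of work W at constant speed s runs for W / s and has the energy size · s^(α-1) · W, so
ρ^(α-1) splits off. -/
theorem output_energy {I : RigidInstance} {M M' : Mem} {g : ℕ → ℝ} (ho : Sorted I M.ord)
    (hv : (I.data M.ord).Optimal M.v) (hM : M.Outputs I M' g) (α : ℝ) :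
    (I.output (enc I M')).energy α = ENNReal.ofReal (I.rho ^ (α - 1))
      * ENNReal.ofReal (∑ j : Fin I.n,
        (I.size j : ℝ) * ((M'.speed j / I.rho) ^ (α - 1) * I.work j)) := by
  have hsp : ∀ j : Fin I.n, 0 < M'.speed j := by
    intro j
    obtain ⟨k, hk, hj⟩ := ho.surj j j.2
    rw [← hj, hM.speed k hk]
    exact mul_pos (hv.pos k hk) (I.rho_pos (I.m_pos j))
  rw [ENNReal.ofReal_sum_of_nonneg, Finset.mul_sum]
  · refine Finset.sum_congr rfl fun j _ => ?_
    have hr := I.rho_pos (I.m_pos j)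
    have hs := hsp j
    have hw := I.work_pos j
    change (I.size j : ℝ≥0∞) * ∫⁻ _ in Set.Ico (M'.start j) (M'.start j + I.work j / M'.speed j),
      (((M'.speed j).toNNReal ^ α : ℝ≥0) : ℝ≥0∞) = _
    have h2 : (((M'.speed j).toNNReal ^ α : ℝ≥0) : ℝ≥0∞) = ENNReal.ofReal (M'.speed j ^ α) := by
      rw [← ENNReal.ofReal_coe_nnreal, NNReal.coe_rpow, Real.coe_toNNReal _ hs.le]
    rw [setLIntegral_const, Real.volume_Ico, add_sub_cancel_left, h2,
      ← ENNReal.ofReal_natCast (I.size j), ← ENNReal.ofReal_mul (by positivity),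
      ← ENNReal.ofReal_mul (by positivity), ← ENNReal.ofReal_mul (by positivity)]
    congr 1
    rw [Real.div_rpow hs.le hr.le, Real.rpow_sub_one hs.ne']
    have := (Real.rpow_pos_of_pos hr (α - 1)).ne'
    field_simp
  · intro j _
    have hr := I.rho_pos (I.m_pos j)
    have hs := hsp j
    have hw := I.work_pos j
    positivity

theorem output_isApproximate {I : RigidInstance} (hI : ∀ j, 2 * I.size j ≤ I.m)
    (hN : I.Nested) {M M' : Mem}
    {g : ℕ → ℝ} (ho : Sorted I M.ord) (hv : (I.data M.ord).Optimal M.v) (hL : M.Listing I)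
    (hk : M.k = I.n) (hM : M.Outputs I M' g)
    (hg : ∀ k < I.n, I.rl (M.ord k) ≤ g k ∧ g k + M.dur I k / I.rho ≤ I.dl (M.ord k))
    (hgg : ∀ i < I.n, ∀ j < I.n, M.off i + M.dur I i ≤ M.off j →
      g i + M.dur I i / I.rho ≤ g j ∨ g j + M.dur I j / I.rho ≤ g i) {α : ℝ} (hα : 1 < α) :
    (I.output (enc I M')).IsApproximate α ((3 - 4 / ((I.m : ℝ) + 1)) ^ (α - 1)) := by
  refine ⟨output_feasible hI ho hv hL hk hM hg hgg, fun S' hS' => ?_⟩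
  rw [output_energy ho hv hM, I.rho_eq]
  gcongr
  refine hv.energy_le hN ho hS' hα (x := fun j => M'.speed j / I.rho) fun k hk => ?_
  have := (I.rho_pos (I.m_pos ⟨k, hk⟩)).ne'
  simp only [hM.speed k hk]
  field_simp

/-- The finishing bound of list scheduling, divided by m + 1, reads off + p ≤ ρ d; scaling by 1/ρ
brings the job into its window. -/
theorem Mem.Listing.window {I : RigidInstance} {M : Mem} (hL : M.Listing I) (hk : M.k = I.n) {k : ℕ}
    (hkn : k < I.n) (hm : 0 < I.m) :
    0 ≤ M.off k / I.rho ∧ (M.off k + M.dur I k) / I.rho ≤ I.dl (M.ord k) - I.rl (M.ord k) := by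
  have h := hL.placed k (hk ▸ hkn)
  have hr := I.rho_pos hm
  refine ⟨div_nonneg h.nonneg hr.le, ?_⟩
  rw [div_le_iff₀ hr, RigidInstance.rho, ← mul_div_assoc, le_div_iff₀ (by positivity)]
  have := h.finish
  change ((I.m : ℝ) + 1) * (M.off k + M.dur I k) ≤ (3 * I.m - 1) * (I.dl (M.ord k) - I.rl (M.ord k))
    at this
  linarith

/-! ## The output of the schedule, and the complete program -/

/-- The factor by which the optimal speeds are increased. -/
def rhoExpr : RealExpr :=
  .div (.sub (.mul (.ofNat (.const 3)) (.ofNat (.read 0 (.const 1)))) (.ofNat (.const 1)))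
    (.add (.ofNat (.read 0 (.const 1))) (.ofNat (.const 1)))

@[simp] theorem eval_rhoExpr (I : RigidInstance) (M : Mem) :
    rhoExpr.eval (enc I M) = I.rho := by
  simp [rhoExpr, RigidInstance.rho]

/-- Writes the speed and the start time of the job at position `k`. -/
def outBody (e : RealExpr) : Program :=
  .seq (.assignReal 4 jobExpr (.mul (.read 6 (nv 10)) rhoExpr))
    (.seq (.assignReal 3 jobExpr e) (incr 10))

/-- Writes the speeds and the start times, which are computed by the expression `e`. -/
def outProg (e : RealExpr) : Program :=
  .seq (setN 10 (.const 0)) (.loop (.natLt (nv 10) (nv 0)) (outBody e))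

/-- The start time of the job at position `k` for a common release time. -/
def startAfterRelease : RealExpr := .add (.read 1 jobExpr) (.div (.read 5 (nv 10)) rhoExpr)

/-- The start time of the job at position `k` for a common deadline. -/
def startBeforeDeadline : RealExpr :=
  .sub (.read 2 jobExpr) (.div (.add (.read 5 (nv 10)) durExpr) rhoExpr)

/-- The complete program. -/
def mainProg (e : RealExpr) : Program :=
  .seq sortProg (.seq freezeProg (.seq listProg (outProg e)))

/-! ### Correctness of the complete program. -/

theorem runs_outProg {I : RigidInstance} {M : Mem} (ho : Sorted I M.ord) {e : RealExpr}
    {g : ℕ → ℝ} (hcost : (outBody e).bound ≤ 200)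
    (he : ∀ M' : Mem, M'.ord = M.ord → M'.off = M.off → M'.v = M.v →
      e.eval (enc I M') = g M'.k) :
    Runs I (outProg e) M (4 + (I.n * 205 + 5)) fun M' => M.Outputs I M' g := by
  refine Runs.seq (Q := fun M' => M' = { M with k := 0 }) (Runs.of_wp (by simp) (by decide)) ?_
  rintro M1 rfl
  refine Runs.mono (Runs.loop (T := 200)
    (fun N M' => M'.k ≤ I.n ∧ N = I.n - M'.k ∧ M'.ord = M.ord ∧ M'.off = M.off ∧ M'.v = M.v ∧
      M'.B = M.B ∧ M'.rj = M.rj ∧ M'.rlo = M.rlo ∧ M'.rhi = M.rhi ∧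
      ∀ k < M'.k, M'.speed (M.ord k) = M.v k * I.rho ∧ M'.start (M.ord k) = g k)
    ?_ I.n _ ⟨Nat.zero_le _, rfl, rfl, rfl, rfl, rfl, rfl, rfl, rfl, by simp⟩) le_rfl ?_
  · rintro N M' ⟨hk, rfl, h1, h2, h3, h4, h5, h6, h7, h8⟩ hb
    simp only [holds_natLt, eval_k, eval_n] at hb
    refine Runs.of_wp ?_ hcost
    have he' := he { M' with speed := Function.update M'.speed (M'.ord M'.k) (M'.v M'.k * I.rho) }
      h1 h2 h3
    simp only [outBody, Program.wp, wp_incr, eval_jobExpr, eval_rmul, eval_v, eval_k, eval_rhoExpr,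
      write_speed, he', write_start, write_k, post_enc]
    refine ⟨I.n - (M'.k + 1), by omega, hb, rfl, h1, h2, h3, h4, h5, h6, h7, fun k hk => ?_⟩
    by_cases hkk : k = M'.k
    · subst hkk
      simp [h1, h3]
    · have hne : M.ord k ≠ M.ord M'.k := fun h => hkk (ho.inj _ (by omega) _ hb h)
      simp only [h1, Function.update_of_ne hne]
      exact h8 k (by omega)
  · rintro M' ⟨⟨N, hk, _, h1, h2, h3, h4, h5, h6, h7, h8⟩, hb⟩
    simp only [holds_natLt, eval_k, eval_n] at hb
    exact ⟨h4, h5, h6, h7, fun k hk => (h8 k (by omega)).1, fun k hk => (h8 k (by omega)).2⟩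

theorem runs_mainProg {I : RigidInstance} (hI : ∀ j, 2 * I.size j ≤ I.m) {e : RealExpr}
    (hcost : (outBody e).bound ≤ 200) (g : Mem → ℕ → ℝ)
    (he : ∀ M M' : Mem, M'.ord = M.ord → M'.off = M.off → M'.v = M.v →
      e.eval (enc I M') = g M M'.k) :
    Runs I (mainProg e) Mem.init (5000 * (I.n ^ 2 + 1)) fun M' => ∃ M : Mem,
      Sorted I M.ord ∧ (I.data M.ord).Optimal M.v ∧ M.Listing I ∧ M.k = I.n ∧
        M.Outputs I M' (g M) := by
  have hJ : ∀ o, Sorted I o → (I.data o).Valid := fun o ho => I.data_valid hI ho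
  refine Runs.mono (Runs.seq (runs_sortProg I Mem.init)
    (T' := (4 + ((I.n + 1) * (5 + (I.n * 260 + 50)) + 5)) +
      ((40 + (2 * I.n * (5 + ((I.n + 1) * 250 + 100)) + 5)) + (4 + (I.n * 205 + 5)))) ?_) ?_
    fun _ h => h
  · rintro M1 ⟨ho1, hfr⟩
    refine Runs.seq (runs_freezeProg hJ ho1 hfr) ?_
    rintro M2 ⟨h2, hv2⟩
    rw [← h2] at ho1 hv2
    refine Runs.seq (runs_listProg hJ ho1 (Mem.dur_pos hI ho1 hv2) hv2.durations) ?_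
    rintro M3 ⟨hL, hk, h3, hv3⟩
    rw [← h3] at ho1
    rw [← h3, ← hv3] at hv2
    exact (runs_outProg ho1 hcost (he M3)).mono le_rfl fun M4 h4 => ⟨M3, ho1, hv2, hL, hk, h4⟩
  -- The total is a quadratic polynomial in `n`; its linear term is absorbed by n ≤ n².
  · nlinarith [Nat.le_self_pow two_ne_zero I.n]

theorem mainProg_startAfterRelease (I : RigidInstance)
    (hr : ∀ i j, I.release i = I.release j) (hI : ∀ j, 2 * I.size j ≤ I.m) :
    Runs I (mainProg startAfterRelease) Mem.init (5000 * (I.n ^ 2 + 1)) fun M' => ∀ α : ℝ, 1 < α →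
      (I.output (enc I M')).IsApproximate α ((3 - 4 / ((I.m : ℝ) + 1)) ^ (α - 1)) := by
  have hN : I.Nested := by
    intro i j hij
    rw [RigidInstance.win, RigidInstance.win, I.rl_val, I.rl_val, I.dl_val, I.dl_val,
      hr i j] at hij
    exact ⟨(hr j i).le, by linarith⟩
  refine (runs_mainProg hI (by decide)
    (fun M k => I.rl (M.ord k) + M.off k / I.rho) ?_).mono le_rfl ?_
  · intro M M' h1 h2 _
    simp [startAfterRelease, h1, h2]
  · rintro M' ⟨M, ho, hv, hL, hk, hM⟩ α hα
    refine output_isApproximate hI hN ho hv hL hk hM (fun k hkn => ?_)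
      (fun i hi j hj hij => Or.inl ?_) hα
    · have hm := I.m_pos ⟨k, hkn⟩
      obtain ⟨h1, h2⟩ := hL.window hk hkn hm
      rw [add_div] at h2
      exact ⟨by linarith, by linarith⟩
    · have hρ := I.rho_pos (I.m_pos ⟨i, hi⟩)
      have h1 : I.rl (M.ord i) = I.rl (M.ord j) := by
        rw [I.rl_val ⟨_, ho.lt i hi⟩, I.rl_val ⟨_, ho.lt j hj⟩]
        exact hr _ _
      have h2 := (div_le_div_iff_of_pos_right hρ).2 hij
      rw [add_div] at h2
      linarith

/-- Time is reversed from the common deadline: a job that list scheduling finishes at time x starts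
x / ρ before the deadline. Jobs on a shared processor swap their order, whence the second
alternative of the separation condition. -/
theorem mainProg_startBeforeDeadline (I : RigidInstance)
    (hd : ∀ i j, I.deadline i = I.deadline j) (hI : ∀ j, 2 * I.size j ≤ I.m) :
    Runs I (mainProg startBeforeDeadline) Mem.init (5000 * (I.n ^ 2 + 1)) fun M' =>
      ∀ α : ℝ, 1 < α →
        (I.output (enc I M')).IsApproximate α ((3 - 4 / ((I.m : ℝ) + 1)) ^ (α - 1)) := by
  have hN : I.Nested := by
    intro i j hij
    rw [RigidInstance.win, RigidInstance.win, I.rl_val, I.rl_val, I.dl_val, I.dl_val,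
      hd i j] at hij
    exact ⟨by linarith, (hd i j).le⟩
  refine (runs_mainProg hI (by decide)
    (fun M k => I.dl (M.ord k) - (M.off k + M.dur I k) / I.rho) ?_).mono le_rfl ?_
  · intro M M' h1 h2 h3
    simp [startBeforeDeadline, h1, h2, h3, Mem.dur]
  · rintro M' ⟨M, ho, hv, hL, hk, hM⟩ α hα
    refine output_isApproximate hI hN ho hv hL hk hM (fun k hkn => ?_)
      (fun i hi j hj hij => Or.inr ?_) hα
    · have hm := I.m_pos ⟨k, hkn⟩
      obtain ⟨h1, h2⟩ := hL.window hk hkn hm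
      rw [add_div] at h2 ⊢
      exact ⟨by linarith, by linarith⟩
    · have hρ := I.rho_pos (I.m_pos ⟨i, hi⟩)
      have h1 : I.dl (M.ord i) = I.dl (M.ord j) := by
        rw [I.dl_val ⟨_, ho.lt i hi⟩, I.dl_val ⟨_, ho.lt j hj⟩]
        exact hd _ _
      have h2 := (div_le_div_iff_of_pos_right hρ).2 hij
      rw [add_div] at h2 ⊢
      rw [add_div]
      linarith

end SpeedScaling

/-! ### The theorem. -/

theorem theorem3 :
    (∃ (P : SpeedScaling.Program) (C : ℕ), ∀ I : SpeedScaling.RigidInstance,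
      (∀ i j, I.release i = I.release j) → (∀ j, 2 * I.size j ≤ I.m) →
        ∃ (s : SpeedScaling.State) (t : ℕ),
          SpeedScaling.Exec P I.input s t ∧ t ≤ C * (I.n ^ 2 + 1) ∧
          ∀ α : ℝ, 1 < α →
            (I.output s).IsApproximate α ((3 - 4 / ((I.m : ℝ) + 1)) ^ (α - 1))) ∧
    (∃ (P : SpeedScaling.Program) (C : ℕ), ∀ I : SpeedScaling.RigidInstance,
      (∀ i j, I.deadline i = I.deadline j) → (∀ j, 2 * I.size j ≤ I.m) →
        ∃ (s : SpeedScaling.State) (t : ℕ),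
          SpeedScaling.Exec P I.input s t ∧ t ≤ C * (I.n ^ 2 + 1) ∧
          ∀ α : ℝ, 1 < α →
            (I.output s).IsApproximate α ((3 - 4 / ((I.m : ℝ) + 1)) ^ (α - 1))) := by
  refine ⟨⟨SpeedScaling.mainProg SpeedScaling.startAfterRelease, 5000, fun I hr hI => ?_⟩,
    ⟨SpeedScaling.mainProg SpeedScaling.startBeforeDeadline, 5000, fun I hd hI => ?_⟩⟩
  · obtain ⟨M', t, h1, h2, h3⟩ := SpeedScaling.mainProg_startAfterRelease I hr hI
    rw [SpeedScaling.enc_init] at h1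
    exact ⟨_, t, h1, h2, h3⟩
  · obtain ⟨M', t, h1, h2, h3⟩ := SpeedScaling.mainProg_startBeforeDeadline I hd hI
    rw [SpeedScaling.enc_init] at h1
    exact ⟨_, t, h1, h2, h3⟩
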